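/- Let $\Gamma$ be a subgroup of finite index of $\mathrm{SL}_2(\mathbb{Z})$, let $r\in\mathbb{R}$, and let $f$ be a modular form of weight $r$ for $\Gamma$ with unimodular multipliers $(\mu_\gamma)_{\gamma\in\Gamma}$; that is, $f$ is holomorphic on the upper half-plane $\mathbb{H}$, satisfies $f(\gamma z)=\mu_\gamma (cz+d)^r f(z)$ for all $\gamma=\left(\begin{smallmatrix}a&b\\c&d\end{smallmatrix}\right)\in\Gamma$ and $z\in\mathbb{H}$ (powers taken with $-\pi<\arg\le\pi$), and grows at most polynomially as $\operatorname{Im} z\to0^+$: $|f(z)|\le C(\operatorname{Im} z)^{-N}$ for some $N\ge 0$, $C$, and all $z$ with $\operatorname{Im} z$ small enough. For a cusp $\mathfrak a\in\mathbb{Q}\cup\{\infty\}$ let $m_{\mathfrak a}$ be its width (the order of the stabilizer of $\mathfrak a$ in $\mathrm{SL}_2(\mathbb{Z})$ modulo $\Gamma$), and let $\sigma_{\mathfrak a}=\gamma\left(\begin{smallmatrix}\sqrt{m_{\mathfrak a}}&0\\0&1/\sqrt{m_{\mathfrak a}}\end{smallmatrix}\right)$, where $\gamma\in\mathrm{SL}_2(\mathbb{Z})$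 satisfies $\gamma(\infty)=\mathfrak a$ and has bottom row $(c,d)$ with $c<0$, or $c=0$ and $d=1$. Writing $(c',d')$ for the bottom row of $\sigma_{\mathfrak a}$, one has a Fourier expansion $$\frac{f(\sigma_{\mathfrak a}z)}{(c'z+d')^{r}}=\sum_{n\ge0}a_n^{\mathfrak a}e^{2\pi i(n+\kappa_{\mathfrak a})z}\qquad(z\in\mathbb{H}),\qquad 0\le\kappa_{\mathfrak a}<1.$$ The form $f$ is called cuspidal at $\mathfrak a$ if $\kappa_{\mathfrak a}>0$ or $a_0^{\mathfrak a}=0$, and $\mathfrak a$ is called non-cuspidal otherwise (this does not depend on the choice of $\gamma$). Assume that $f$ is not a cusp form, i.e. that at least one cusp is non-cuspidal. For $x\in\mathbb{R}$ let $\tau_x\in[-\infty,+\infty]$ be the supremum of all $\tau\in\mathbb{R}$ for which there is a constant $C$ such that $$\left|x-\frac pq\right|\le\frac{C}{q^{\tau}}$$ holds for infinitely many non-cuspidal rationals $p/q$ (written in lowest terms with $q\geq 1$). Then, for every $2\le\tau\le+\infty$, the Hausdorff dimension of the set $\{x\in\mathbb{R}:\tau_x=\tau\}$ is $2/\tau$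 (where $2/\infty=0$). -/

import Mathlib

open scoped MatrixGroups ENNReal Manifold

noncomputable section

/-- `f` is a modular form of real weight `r` for the subgroup `Γ` of `SL(2, ℤ)` with unimodular
multipliers `μ`: it is holomorphic on the upper half-plane, it satisfies
`f (γ z) = μ_γ (c z + d) ^ r f z` for every `γ ∈ Γ` with bottom row `(c, d)` (complex powers are
taken with the branch `-π < arg ≤ π`), and it grows at most polynomially as `Im z → 0⁺`. -/
structure IsModularFormOfWeight (Γ : Subgroup SL(2, ℤ)) (r : ℝ) (μ : Γ → Circle)
    (f : UpperHalfPlane → ℂ) : Prop where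
  holomorphic : MDifferentiable 𝓘(ℂ) 𝓘(ℂ) f
  map_smul : ∀ (γ : Γ) (z : UpperHalfPlane),
    f ((γ : SL(2, ℤ)) • z) =
      (μ γ : ℂ) * (((γ : SL(2, ℤ)) 1 0 : ℂ) * (z : ℂ) + ((γ : SL(2, ℤ)) 1 1 : ℂ)) ^ (r : ℂ) * f z
  polynomial_growth : ∃ (N : ℕ) (C δ : ℝ), 0 < δ ∧
    ∀ z : UpperHalfPlane, z.im < δ → ‖f z‖ ≤ C / z.im ^ N

/-- The stabilizer in `SL(2, ℤ)` of a cusp; the cusps are the points of `ℚ ∪ {∞}`. -/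
def cuspStabilizer (𝔞 : OnePoint ℚ) : Subgroup SL(2, ℤ) :=
  (MulAction.stabilizer (GL (Fin 2) ℚ) 𝔞).comap (Matrix.SpecialLinearGroup.mapGL ℚ)

/-- The width of the cusp `𝔞`: the order of the stabilizer of `𝔞` in `SL(2, ℤ)` modulo `Γ`. -/
def cuspWidth (Γ : Subgroup SL(2, ℤ)) (𝔞 : OnePoint ℚ) : ℕ :=
  Γ.relIndex (cuspStabilizer 𝔞)

theorem cuspWidth_pos (Γ : Subgroup SL(2, ℤ)) [Γ.FiniteIndex] (𝔞 : OnePoint ℚ) :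
    0 < cuspWidth Γ 𝔞 :=
  Nat.pos_of_ne_zero (Subgroup.FiniteIndex.index_ne_zero (H := Γ.subgroupOf (cuspStabilizer 𝔞)))

/-- The diagonal matrix with entries `√m` and `1 / √m`. -/
def sqrtDiag (m : ℕ) (hm : 0 < m) : SL(2, ℝ) :=
  ⟨!![√(m : ℝ), 0; 0, 1 / √(m : ℝ)], by
    have : √(m : ℝ) ≠ 0 := (Real.sqrt_pos.2 (Nat.cast_pos.2 hm)).ne'
    simp [Matrix.det_fin_two, this]⟩

/-- `γ ∈ SL(2, ℤ)` maps `∞` to the cusp `𝔞` and is normalized in sign: its bottom row `(c, d)`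
satisfies either `c < 0`, or `c = 0` and `d = 1`. -/
def IsCuspMatrix (γ : SL(2, ℤ)) (𝔞 : OnePoint ℚ) : Prop :=
  Matrix.SpecialLinearGroup.mapGL ℚ γ • (OnePoint.infty : OnePoint ℚ) = 𝔞 ∧
    (γ 1 0 < 0 ∨ (γ 1 0 = 0 ∧ γ 1 1 = 1))

/-- The scaling matrix `γ η` of the cusp `𝔞`, where `γ ∞ = 𝔞` and `η` is the diagonal matrix with
entries `√m` and `1 / √m`, `m` being the width of `𝔞`. -/
def scalingMatrix (Γ : Subgroup SL(2, ℤ)) [Γ.FiniteIndex] (𝔞 : OnePoint ℚ) (γ : SL(2, ℤ)) :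
    SL(2, ℝ) :=
  Matrix.SpecialLinearGroup.map (Int.castRingHom ℝ) γ * sqrtDiag (cuspWidth Γ 𝔞) (cuspWidth_pos Γ 𝔞)

/-- The slash operator of weight `r` for a matrix `σ` of determinant `1`, with bottom row `(c, d)`:
`z ↦ f (σ z) / (c z + d) ^ r`. -/
def slashWeight (r : ℝ) (f : UpperHalfPlane → ℂ) (σ : SL(2, ℝ)) (z : UpperHalfPlane) : ℂ :=
  f (σ • z) / ((σ 1 0 : ℂ) * (z : ℂ) + (σ 1 1 : ℂ)) ^ (r : ℂ)

/-- `∑ n ≥ 0, a n * exp (2 π i (n + κ) z)`, with `0 ≤ κ < 1`, is the Fourier expansion of `f` at the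
cusp `𝔞`, relative to the scaling matrix built from `γ`. -/
def IsCuspExpansion (Γ : Subgroup SL(2, ℤ)) [Γ.FiniteIndex] (r : ℝ) (f : UpperHalfPlane → ℂ)
    (𝔞 : OnePoint ℚ) (γ : SL(2, ℤ)) (κ : ℝ) (a : ℕ → ℂ) : Prop :=
  IsCuspMatrix γ 𝔞 ∧ 0 ≤ κ ∧ κ < 1 ∧ ∀ z : UpperHalfPlane,
    HasSum (fun n : ℕ ↦ a n * Complex.exp (2 * Real.pi * Complex.I * ((n : ℂ) + (κ : ℂ)) * (z : ℂ)))
      (slashWeight r f (scalingMatrix Γ 𝔞 γ) z)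

/-- `f` is cuspidal at the cusp `𝔞`: in its Fourier expansion at `𝔞`, either the cusp parameter `κ`
is positive or the coefficient `a 0` vanishes. (A modular form has an expansion at every cusp,
and whether this condition holds does not depend on the choice of the scaling matrix.) -/
def IsCuspidalAt (Γ : Subgroup SL(2, ℤ)) [Γ.FiniteIndex] (r : ℝ) (f : UpperHalfPlane → ℂ)
    (𝔞 : OnePoint ℚ) : Prop :=
  ∀ (γ : SL(2, ℤ)) (κ : ℝ) (a : ℕ → ℂ), IsCuspExpansion Γ r f 𝔞 γ κ a → 0 < κ ∨ a 0 = 0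

/-- `τ` is an admissible exponent for `x`: for some constant `C`, the inequality
`|x - p/q| ≤ C / q ^ τ` holds for infinitely many rationals `p/q` at which `f` is not cuspidal. -/
def IsNonCuspidalExponent (Γ : Subgroup SL(2, ℤ)) [Γ.FiniteIndex] (r : ℝ) (f : UpperHalfPlane → ℂ)
    (x τ : ℝ) : Prop :=
  ∃ C : ℝ, {y : ℚ | ¬ IsCuspidalAt Γ r f (y : OnePoint ℚ) ∧
    |x - (y : ℝ)| ≤ C / (y.den : ℝ) ^ τ}.Infinite

/-- The exponent of approximation `τ_x` of `x` by non-cuspidal rationals: the supremum, possibly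
infinite, of the admissible exponents. -/
def nonCuspidalExponent (Γ : Subgroup SL(2, ℤ)) [Γ.FiniteIndex] (r : ℝ) (f : UpperHalfPlane → ℂ)
    (x : ℝ) : EReal :=
  sSup {t : EReal | ∃ τ : ℝ, t = (τ : EReal) ∧ IsNonCuspidalExponent Γ r f x τ}

end

/-! ### Invariance of non-cuspidality under the group -/

/-! This is a Jarník–Besicovitch theorem for the non-cuspidal rationals.

Upper bound: if `τ_x = τ`, then for every `t < τ` infinitely many rationals approximate `x` to order
`t`. Covering by intervals around `p/q` of length about `q ^ (-t)` gives a convergent sum as soon as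
`t * s > 2`, so such `x` form an `s`-null set (`hausdorffMeasure_approximable`). No modularity
enters here.

Lower bound: non-cuspidality is invariant under `Γ` (`not_isCuspidalAt_smul`), so one non-cuspidal
cusp yields a whole orbit. By finite index, every rational of denominator `q` has an orbit member
within `O(1/q²)` and of denominator `O(q)` (`exists_orbit_rat_near`). With Dirichlet's theorem, an
interval of radius `ρ` then contains at least `c ρ Q²` non-cuspidal rationals of denominator at most
`Q`, for `Q` large in terms of `ρ` alone (`exists_card_ge`).

This count feeds a Cantor construction with very rapidly growing denominators (`RatTree`). The
uniform measure on branches pushes forward to a measure `ν` with `ν ≪ μH[s]` for all `0 < s < 2/τ`,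
whose points are all approximable to order `τ`. The same absolute continuity makes `ν` ignore the
rationals and the numbers approximable to any order `τ + 1/(n+1)`, since these are `s`-null for some
`s < 2/τ`. Hence `ν` is carried by the exact level set, whose dimension is therefore at least `2/τ`.
-/

open UpperHalfPlane in
theorem continuous_clog_linear (a b : ℝ) :
    Continuous fun z : ℍ ↦ Complex.log ((a : ℂ) * (z : ℂ) + (b : ℂ)) := by
  -- For `a ≠ 0` the value `a z + b` is never real, so it avoids the branch cut; for `a = 0` the cut
  -- is harmless because the function is constant.
  by_cases ha : a = 0
  · simpa [ha] using! continuous_const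
  · refine Continuous.clog (by fun_prop) fun z ↦ Or.inr ?_
    simp [ha, z.im_ne_zero]

/-- The values of `G` lie in one coset of the discrete group `2πiℤ`, and the domain is connected. -/
theorem eq_of_continuous_of_exp_eq {X : Type*} [TopologicalSpace X] [PreconnectedSpace X]
    {G : X → ℂ} (hG : Continuous G) (e : ℂ) (h : ∀ x, Complex.exp (G x) = e) (x y : X) :
    G x = G y := by
  have h1 : ∀ z, ∃ n : ℤ, G z = G x + n * (2 * Real.pi * Complex.I) := fun z ↦
    Complex.exp_eq_exp_iff_exists_int.1 ((h z).trans (h x).symm)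
  choose n hn using h1
  have hc : Continuous n := by
    rw [Int.isClosedEmbedding_coe_real.isEmbedding.continuous_iff]
    have : ((↑) : ℤ → ℝ) ∘ n = fun z ↦ (G z - G x).im / (2 * Real.pi) := by
      ext z
      rw [hn z]
      simp [Real.pi_ne_zero]
    rw [this]
    fun_prop
  have h2 : n x = n y := PreconnectedSpace.constant inferInstance hc
  rw [hn y, ← h2, ← hn x]

-- Real powers are not multiplicative, so the automorphy factors match only up to a constant. The
-- factor `e` will be the sign `±1` forced by the normalization of cusp matrices.
open UpperHalfPlane in
theorem exists_slashWeight_eq_mul {Γ : Subgroup SL(2, ℤ)} {r : ℝ} {μ : Γ → Circle} {f : ℍ → ℂ}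
    (hf : IsModularFormOfWeight Γ r μ f) (γ : Γ) (σ σ' : SL(2, ℝ)) (e : ℂ) (he : e ≠ 0)
    (hsmul : ∀ z : ℍ, σ' • z = (γ : SL(2, ℤ)) • σ • z)
    (hden : ∀ z : ℍ, (σ' 1 0 : ℂ) * z + (σ' 1 1 : ℂ) = e * ((((γ : SL(2, ℤ)) 1 0 : ℂ) * ((σ • z : ℍ) : ℂ)
      + ((γ : SL(2, ℤ)) 1 1 : ℂ)) * ((σ 1 0 : ℂ) * z + (σ 1 1 : ℂ)))) :
    ∃ K : ℂ, K ≠ 0 ∧ ∀ z, slashWeight r f σ' z = K * slashWeight r f σ z := by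
  have hrow : ∀ s : SL(2, ℝ), s 1 0 ≠ 0 ∨ s 1 1 ≠ 0 := by
    intro s
    by_contra! h
    have := s.det_coe
    rw [Matrix.det_fin_two] at this
    simp [h.1, h.2] at this
  have hrow' : ∀ s : SL(2, ℤ), (s 1 0 : ℝ) ≠ 0 ∨ (s 1 1 : ℝ) ≠ 0 := by
    intro s
    by_contra! h
    have := s.det_coe
    have h1 : s 1 0 = 0 := by exact_mod_cast h.1
    have h2 : s 1 1 = 0 := by exact_mod_cast h.2
    rw [Matrix.det_fin_two] at this
    simp [h1, h2] at this
  have hne : ∀ {a b : ℝ} (_ : a ≠ 0 ∨ b ≠ 0) (z : ℍ), (a : ℂ) * z + (b : ℂ) ≠ 0 := by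
    intro a b h z
    refine UpperHalfPlane.linear_ne_zero (cd := ![a, b]) z fun h0 ↦ ?_
    have h1 := congr_fun h0 0
    have h2 := congr_fun h0 1
    simp at h1 h2
    tauto
  set u : ℍ → ℂ := fun z ↦ ((((γ : SL(2, ℤ)) 1 0 : ℤ) : ℝ) : ℂ) * ((σ • z : ℍ) : ℂ) +
    ((((γ : SL(2, ℤ)) 1 1 : ℤ) : ℝ) : ℂ) with hu
  set v : ℍ → ℂ := fun z ↦ (σ 1 0 : ℂ) * z + (σ 1 1 : ℂ) with hv
  set w : ℍ → ℂ := fun z ↦ (σ' 1 0 : ℂ) * z + (σ' 1 1 : ℂ) with hw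
  have hu0 : ∀ z, u z ≠ 0 := fun z ↦ hne (hrow' _) _
  have hv0 : ∀ z, v z ≠ 0 := fun z ↦ hne (hrow _) _
  have hw0 : ∀ z, w z ≠ 0 := fun z ↦ hne (hrow _) _
  have hden' : ∀ z, w z = e * (u z * v z) := by
    intro z
    simpa [hu, hv, hw] using hden z
  -- `exp (r * G)` measures the failure of the cocycle relation. Since `exp G = e⁻¹` and `G` is
  -- continuous, `G` is constant.
  set G : ℍ → ℂ := fun z ↦ Complex.log (u z) + Complex.log (v z) - Complex.log (w z) with hG
  have hGc : Continuous G := by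
    refine ((Continuous.add ?_ ?_).sub ?_)
    · exact (continuous_clog_linear _ _).comp (continuous_const_smul σ)
    · exact continuous_clog_linear _ _
    · exact continuous_clog_linear _ _
  have hGe : ∀ z, Complex.exp (G z) = e⁻¹ := by
    intro z
    have := hden' z
    have h1 := hu0 z
    have h2 := hv0 z
    rw [hG, Complex.exp_sub, Complex.exp_add, Complex.exp_log h1, Complex.exp_log h2,
      Complex.exp_log (hw0 z), this]
    field_simp
  have hGconst := eq_of_continuous_of_exp_eq hGc _ hGe
  refine ⟨μ γ * Complex.exp (G UpperHalfPlane.I * r), by simp, fun z ↦ ?_⟩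
  rw [hGconst UpperHalfPlane.I z]
  unfold slashWeight
  rw [hsmul z, hf.map_smul γ (σ • z)]
  have e1 : (((γ : SL(2, ℤ)) 1 0 : ℂ) * ((σ • z : ℍ) : ℂ) + ((γ : SL(2, ℤ)) 1 1 : ℂ)) = u z := by
    simp [hu]
  rw [e1]
  change _ * u z ^ (r : ℂ) * _ / w z ^ (r : ℂ) = _ * (_ / v z ^ (r : ℂ))
  rw [Complex.cpow_def_of_ne_zero (hu0 z), Complex.cpow_def_of_ne_zero (hv0 z),
    Complex.cpow_def_of_ne_zero (hw0 z), hG]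
  rw [sub_mul, add_mul, Complex.exp_sub, Complex.exp_add]
  have := Complex.exp_ne_zero (Complex.log (v z) * r)
  have := Complex.exp_ne_zero (Complex.log (w z) * r)
  field_simp

-- Conjugation by `γ` preserves `Γ`, carries one stabilizer to the other, and preserves relative
-- indices.
open scoped Pointwise in
theorem cuspWidth_smul {Γ : Subgroup SL(2, ℤ)} {γ : SL(2, ℤ)} (hγ : γ ∈ Γ) (𝔞 : OnePoint ℚ) :
    cuspWidth Γ (Matrix.SpecialLinearGroup.mapGL ℚ γ • 𝔞) = cuspWidth Γ 𝔞 := by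
  unfold cuspWidth
  have h1 : MulAut.conj γ • Γ = Γ := by
    ext x
    rw [Subgroup.mem_pointwise_smul_iff_inv_smul_mem]
    simp only [← map_inv, MulAut.smul_def, MulAut.conj_apply, inv_inv]
    constructor
    · intro h
      simpa [mul_assoc] using Γ.mul_mem (Γ.mul_mem hγ h) (Γ.inv_mem hγ)
    · intro h
      exact Γ.mul_mem (Γ.mul_mem (Γ.inv_mem hγ) h) hγ
  have h2 : MulAut.conj γ • cuspStabilizer 𝔞 =
      cuspStabilizer (Matrix.SpecialLinearGroup.mapGL ℚ γ • 𝔞) := by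
    ext x
    rw [Subgroup.mem_pointwise_smul_iff_inv_smul_mem]
    simp only [← map_inv, MulAut.smul_def, MulAut.conj_apply, inv_inv, cuspStabilizer,
      Subgroup.mem_comap, MulAction.mem_stabilizer_iff, map_mul, mul_smul]
    rw [map_inv, inv_smul_eq_iff]
  rw [← h2]
  conv_lhs => rw [← h1]
  exact Subgroup.relIndex_pointwise_smul _ _ _

theorem mapGL_neg_smul_infty (g : SL(2, ℤ)) :
    Matrix.SpecialLinearGroup.mapGL ℚ (-g) • (OnePoint.infty : OnePoint ℚ) =
      Matrix.SpecialLinearGroup.mapGL ℚ g • (OnePoint.infty : OnePoint ℚ) := by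
  simp [OnePoint.smul_infty_eq_ite]

theorem exists_isCuspMatrix (g : SL(2, ℤ)) : ∃ e : ℤ, (e = 1 ∨ e = -1) ∧ ∃ g' : SL(2, ℤ),
    (∀ i j, g' i j = e * g i j) ∧
    IsCuspMatrix g' (Matrix.SpecialLinearGroup.mapGL ℚ g • (OnePoint.infty : OnePoint ℚ)) := by
  have hdet := g.det_coe
  rw [Matrix.det_fin_two] at hdet
  by_cases h : g 1 0 < 0 ∨ (g 1 0 = 0 ∧ g 1 1 = 1)
  · exact ⟨1, Or.inl rfl, g, by simp, rfl, h⟩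
  · refine ⟨-1, Or.inr rfl, -g, by simp, mapGL_neg_smul_infty g, ?_⟩
    push Not at h
    rcases h.1.eq_or_lt with h0 | h0
    · right
      have h3 := h.2 h0.symm
      rw [← h0] at hdet
      have h4 : g 1 1 = 1 ∨ g 1 1 = -1 := Int.isUnit_iff.1 (.of_mul_eq_one (g 0 0) (by linarith))
      simp only [Matrix.SpecialLinearGroup.coe_neg, Matrix.neg_apply]
      omega
    · left
      simpa using h0

/-- Since widths agree along the orbit, the scaling matrix at the image cusp is `±γσ`. The expansion
is thus multiplied by a nonzero constant, with `κ` unchanged. -/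
theorem not_isCuspidalAt_smul {Γ : Subgroup SL(2, ℤ)} [Γ.FiniteIndex] {r : ℝ} {μ : Γ → Circle}
    {f : UpperHalfPlane → ℂ} (hf : IsModularFormOfWeight Γ r μ f) {𝔞 : OnePoint ℚ}
    (h : ¬ IsCuspidalAt Γ r f 𝔞) {γ : SL(2, ℤ)} (hγ : γ ∈ Γ) :
    ¬ IsCuspidalAt Γ r f (Matrix.SpecialLinearGroup.mapGL ℚ γ • 𝔞) := by
  unfold IsCuspidalAt at h ⊢
  push Not at h ⊢
  obtain ⟨δ, κ, a, ⟨hδ, hκ0, hκ1, hsum⟩, hκ, ha⟩ := h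
  obtain ⟨e, he, δ', hδ', hcm⟩ := exists_isCuspMatrix (γ * δ)
  rw [map_mul, mul_smul, hδ.1] at hcm
  set σ := scalingMatrix Γ 𝔞 δ with hσ
  set σ' := scalingMatrix Γ (Matrix.SpecialLinearGroup.mapGL ℚ γ • 𝔞) δ' with hσ'
  have hcoef : ∀ i j, σ' i j = (e : ℝ) * (((γ i 0 : ℤ) : ℝ) * σ 0 j + ((γ i 1 : ℤ) : ℝ) * σ 1 j) := by
    intro i j
    simp only [hσ, hσ', scalingMatrix, cuspWidth_smul hγ, Matrix.SpecialLinearGroup.coe_mul,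
      Matrix.mul_apply, Fin.sum_univ_two, Matrix.SpecialLinearGroup.map_apply_coe,
      RingHom.mapMatrix_apply, Matrix.map_apply, hδ']
    simp
    ring
  have he0 : (e : ℂ) ≠ 0 := by rcases he with rfl | rfl <;> simp
  have hσden : ∀ z : UpperHalfPlane, (σ 1 0 : ℂ) * z + (σ 1 1 : ℂ) ≠ 0 := fun z ↦ by
    have := UpperHalfPlane.denom_ne_zero (σ : GL (Fin 2) ℝ) z
    simpa [UpperHalfPlane.denom] using this
  have hden : ∀ z : UpperHalfPlane, (σ' 1 0 : ℂ) * z + (σ' 1 1 : ℂ) = (e : ℂ) *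
      (((γ 1 0 : ℂ) * ((σ • z : UpperHalfPlane) : ℂ) + (γ 1 1 : ℂ)) *
        ((σ 1 0 : ℂ) * z + (σ 1 1 : ℂ))) := by
    intro z
    have := hσden z
    rw [UpperHalfPlane.coe_specialLinearGroup_apply]
    simp only [hcoef, Algebra.algebraMap_self, RingHom.id_apply]
    push_cast
    field_simp
    ring
  have hsm : ∀ z : UpperHalfPlane, σ' • z = γ • σ • z := by
    intro z
    have hz := hσden z
    have hz' : (σ' 1 0 : ℂ) * z + (σ' 1 1 : ℂ) ≠ 0 := by
      have := UpperHalfPlane.denom_ne_zero (σ' : GL (Fin 2) ℝ) z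
      simpa [UpperHalfPlane.denom] using this
    rw [hden] at hz'
    have hz2 := right_ne_zero_of_mul hz'
    have hz3 := left_ne_zero_of_mul hz2
    ext
    rw [UpperHalfPlane.coe_specialLinearGroup_apply, UpperHalfPlane.coe_specialLinearGroup_apply γ]
    simp only [Algebra.algebraMap_self, RingHom.id_apply, algebraMap_int_eq, eq_intCast,
      Complex.ofReal_intCast]
    rw [hden, div_eq_div_iff hz' hz3]
    have : (((σ • z : UpperHalfPlane) : ℂ)) * ((σ 1 0 : ℂ) * z + (σ 1 1 : ℂ)) =
        (σ 0 0 : ℂ) * z + (σ 0 1 : ℂ) := by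
      rw [UpperHalfPlane.coe_specialLinearGroup_apply]
      simp only [Algebra.algebraMap_self, RingHom.id_apply]
      exact div_mul_cancel₀ _ hz
    simp only [hcoef]
    push_cast
    linear_combination (-(e : ℂ) * (γ 0 0 : ℂ)) * ((γ 1 0 : ℂ) * ((σ • z : UpperHalfPlane) : ℂ) + (γ 1 1 : ℂ)) * this
  obtain ⟨K, hK, hKs⟩ := exists_slashWeight_eq_mul hf ⟨γ, hγ⟩ σ σ' e he0 hsm hden
  refine ⟨δ', κ, fun n ↦ K * a n, ⟨hcm, hκ0, hκ1, fun z ↦ ?_⟩, hκ, mul_ne_zero hK ha⟩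
  rw [hKs z]
  simpa [mul_assoc] using (hsum z).mul_left K

/-! ### Every rational is close to a rational in a given orbit -/

/-- Some `g T^m g⁻¹` lies in `Γ`, so `h = ±T^(mk) g⁻¹ δ` works for every `k`. The shear adds `mk`
times the lower entry to the upper one, which allows the signs of the first column to be arranged.
These signs later prevent cancellation in denominators. -/
theorem exists_mul_smul_infty_mem_orbit (Γ : Subgroup SL(2, ℤ)) [Γ.FiniteIndex] (δ g : SL(2, ℤ)) :
    ∃ h : SL(2, ℤ), 1 ≤ h 0 0 ∧ 0 ≤ h 1 0 ∧ ∃ γ ∈ Γ,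
      Matrix.SpecialLinearGroup.mapGL ℚ (g * h) • (OnePoint.infty : OnePoint ℚ) =
        Matrix.SpecialLinearGroup.mapGL ℚ (γ * δ) • (OnePoint.infty : OnePoint ℚ) := by
  obtain ⟨m, hm, -, hmem⟩ := Subgroup.exists_pow_mem_of_index_ne_zero
    (Subgroup.FiniteIndex.index_ne_zero (H := Γ)) (g * ModularGroup.T * g⁻¹)
  rw [conj_pow] at hmem
  set x := g⁻¹ * δ with hx
  have key : ∀ k : ℕ, ∃ h : SL(2, ℤ), h 0 0 = x 0 0 + m * k * x 1 0 ∧ h 1 0 = x 1 0 ∧ ∃ γ ∈ Γ,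
      g * h = γ * δ := by
    intro k
    have hT : ((ModularGroup.T ^ m) ^ k : SL(2, ℤ)) = ModularGroup.T ^ ((m * k : ℕ) : ℤ) := by
      rw [← pow_mul, zpow_natCast]
    refine ⟨(ModularGroup.T ^ m) ^ k * x, ?_, ?_, (g * ModularGroup.T ^ m * g⁻¹) ^ k,
      Γ.pow_mem hmem k, ?_⟩
    · rw [hT, Matrix.SpecialLinearGroup.coe_mul, ModularGroup.coe_T_zpow]
      simp [Matrix.mul_apply, Fin.sum_univ_two]
    · rw [hT, Matrix.SpecialLinearGroup.coe_mul, ModularGroup.coe_T_zpow]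
      simp [Matrix.mul_apply, Fin.sum_univ_two]
    · rw [conj_pow, hx]
      group
  have hm1 : (1 : ℤ) ≤ m := by exact_mod_cast hm
  -- With `k = |x 0 0| + 1` the shear outweighs `x 0 0` whenever `x 1 0 ≠ 0`; if `x 1 0 = 0`, then
  -- `x 0 0 = ±1` and a sign change suffices.
  obtain ⟨h, h1, h2, γ, hγ, h3⟩ := key ((x 0 0).natAbs + 1)
  push_cast at h1
  have hneg : ∀ h : SL(2, ℤ), g * -h = -(g * h) := fun h ↦ by
    ext i j
    simp
  have hdet := x.det_coe
  rw [Matrix.det_fin_two] at hdet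
  rcases lt_trichotomy (x 1 0) 0 with hc | hc | hc
  · refine ⟨-h, ?_, ?_, γ, hγ, ?_⟩
    · rw [Matrix.SpecialLinearGroup.coe_neg, Matrix.neg_apply, h1]
      have : |x 0 0| + 1 ≤ m * (|x 0 0| + 1) * (-x 1 0) := by
        have := abs_nonneg (x 0 0)
        nlinarith [mul_nonneg (by linarith : (0 : ℤ) ≤ m - 1) (by linarith : (0:ℤ) ≤ |x 0 0| + 1),
          mul_nonneg (by positivity : (0 : ℤ) ≤ m * (|x 0 0| + 1)) (by linarith : (0 : ℤ) ≤ -x 1 0 - 1)]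
      have := le_abs_self (x 0 0)
      linarith
    · rw [Matrix.SpecialLinearGroup.coe_neg, Matrix.neg_apply, h2]
      linarith
    · rw [hneg, mapGL_neg_smul_infty, h3]
  · have h4 : x 0 0 = 1 ∨ x 0 0 = -1 :=
      Int.isUnit_iff.1 (.of_mul_eq_one (x 1 1) (by rw [hc] at hdet; linarith))
    rw [hc] at h1 h2
    rcases h4 with h4 | h4
    · exact ⟨h, by rw [h1]; linarith, by rw [h2], γ, hγ, by rw [h3]⟩
    · refine ⟨-h, ?_, ?_, γ, hγ, by rw [hneg, mapGL_neg_smul_infty, h3]⟩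
      · rw [Matrix.SpecialLinearGroup.coe_neg, Matrix.neg_apply, h1]; linarith
      · rw [Matrix.SpecialLinearGroup.coe_neg, Matrix.neg_apply, h2]; simp
  · refine ⟨h, ?_, h2 ▸ hc.le, γ, hγ, by rw [h3]⟩
    rw [h1]
    have : |x 0 0| + 1 ≤ m * (|x 0 0| + 1) * (x 1 0) := by
      have := abs_nonneg (x 0 0)
      nlinarith [mul_nonneg (by linarith : (0 : ℤ) ≤ m - 1) (by linarith : (0:ℤ) ≤ |x 0 0| + 1),
        mul_nonneg (by positivity : (0 : ℤ) ≤ m * (|x 0 0| + 1)) (by linarith : (0 : ℤ) ≤ x 1 0 - 1)]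
    have := neg_abs_le (x 0 0)
    linarith

theorem exists_specialLinearGroup_of_rat (y : ℚ) : ∃ g : SL(2, ℤ),
    g 0 0 = y.num ∧ g 1 0 = y.den ∧ 0 ≤ g 1 1 ∧ g 1 1 ≤ y.den := by
  obtain ⟨u, v, huv⟩ : IsCoprime y.num (y.den : ℤ) := Rat.isCoprime_num_den y
  have hd : (0 : ℤ) < y.den := by exact_mod_cast y.pos
  -- The Bézout coefficient is reduced modulo the denominator, which makes the bottom row
  -- nonnegative and bounded.
  refine ⟨⟨!![y.num, -v - y.num * (u / y.den); y.den, u % y.den], ?_⟩, rfl, rfl,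
    Int.emod_nonneg _ hd.ne', (Int.emod_lt_of_pos _ hd).le⟩
  rw [Matrix.det_fin_two_of]
  linear_combination huv + y.num * (Int.emod_add_mul_ediv u y.den)

/-- The correcting matrix depends only on the coset of `g⁻¹`, so finitely many matrices serve all
rationals, and `C` bounds the sums of their first-column entries. -/
theorem exists_orbit_rat_near (Γ : Subgroup SL(2, ℤ)) [Γ.FiniteIndex] (δ : SL(2, ℤ)) :
    ∃ C : ℕ, ∀ y : ℚ, ∃ y' : ℚ, (∃ γ ∈ Γ,
      Matrix.SpecialLinearGroup.mapGL ℚ (γ * δ) • (OnePoint.infty : OnePoint ℚ) = (y' : OnePoint ℚ)) ∧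
      |(y : ℝ) - y'| ≤ C / (y.den : ℝ) ^ 2 ∧ y'.den ≤ C * y.den := by
  choose h h1 h2 γ hγ h3 using exists_mul_smul_infty_mem_orbit Γ δ
  have : Finite (SL(2, ℤ) ⧸ Γ) := Subgroup.finite_quotient_of_finiteIndex
  obtain ⟨C, hC⟩ := Finite.exists_le (fun q : SL(2, ℤ) ⧸ Γ ↦
    ((h q.out⁻¹) 0 0 + (h q.out⁻¹) 1 0).toNat)
  refine ⟨C, fun y ↦ ?_⟩
  obtain ⟨g, hg0, hg1, hg2, hg3⟩ := exists_specialLinearGroup_of_rat y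
  set q : SL(2, ℤ) ⧸ Γ := QuotientGroup.mk g⁻¹ with hq
  have hqΓ : g * q.out ∈ Γ := by
    have h5 : (QuotientGroup.mk q.out : SL(2, ℤ) ⧸ Γ) = QuotientGroup.mk g⁻¹ := by
      rw [← hq]; exact Quotient.out_eq q
    have := QuotientGroup.eq.1 h5.symm
    simpa using this
  set a := h q.out⁻¹ with ha
  have hCq : a 0 0 + a 1 0 ≤ C := by
    have := hC q
    rw [Int.toNat_le] at this
    exact this
  have ha1 := h1 q.out⁻¹
  have ha2 := h2 q.out⁻¹
  rw [← ha] at ha1 ha2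
  have hd : (0 : ℤ) < y.den := by exact_mod_cast y.pos
  have e0 : (g * a) 0 0 = g 0 0 * a 0 0 + g 0 1 * a 1 0 := by
    simp [Matrix.mul_apply, Fin.sum_univ_two]
  have e1 : (g * a) 1 0 = g 1 0 * a 0 0 + g 1 1 * a 1 0 := by
    simp [Matrix.mul_apply, Fin.sum_univ_two]
  set P := (g * a) 0 0 with hP
  set Q := (g * a) 1 0 with hQ
  have hdet := g.det_coe
  rw [Matrix.det_fin_two] at hdet
  rw [hg0, hg1] at hdet
  rw [hg0] at e0
  rw [hg1] at e1
  have hQ1 : (y.den : ℤ) ≤ Q := by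
    rw [e1]
    nlinarith [mul_nonneg hg2 ha2]
  have hQ2 : Q ≤ C * y.den := by
    rw [e1]
    nlinarith [mul_le_mul_of_nonneg_right hg3 ha2]
  have hQpos : 0 < Q := hd.trans_le hQ1
  refine ⟨(P : ℚ) / Q, ⟨(g * q.out) * γ q.out⁻¹, Γ.mul_mem hqΓ (hγ _), ?_⟩, ?_, ?_⟩
  · have e2 := h3 q.out⁻¹
    rw [← ha] at e2
    rw [mul_assoc, map_mul, mul_smul, ← e2, ← mul_smul, ← map_mul]
    have : g * q.out * (q.out⁻¹ * a) = g * a := by group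
    have hent : ∀ (M : SL(2, ℤ)) (i j : Fin 2),
        (Matrix.SpecialLinearGroup.mapGL ℚ M : GL (Fin 2) ℚ) i j = (M i j : ℚ) := fun M i j ↦ by
      simp
    rw [this, OnePoint.smul_infty_eq_ite, hent, hent, if_neg]
    exact_mod_cast hQpos.ne'
  · have hy : (y : ℝ) = (y.num : ℝ) / y.den := Rat.cast_def y
    have hd' : (0 : ℝ) < y.den := by exact_mod_cast hd
    have hQ' : (0 : ℝ) < Q := by exact_mod_cast hQpos
    -- The cross difference of the first columns of `g` and `g * a` is `det g * a 1 0 = a 1 0`.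
    have e3 : (y : ℝ) - ((P : ℚ) / Q : ℚ) = a 1 0 / (y.den * Q) := by
      rw [hy]
      push_cast
      have : (y.num : ℝ) * Q - y.den * P = a 1 0 := by
        rw [e0, e1]
        have : (y.num : ℝ) * g 1 1 - g 0 1 * y.den = 1 := by exact_mod_cast hdet
        push_cast
        linear_combination (a 1 0 : ℝ) * this
      field_simp
      linarith
    have ha2' : (0 : ℝ) ≤ a 1 0 := by exact_mod_cast ha2
    rw [e3, abs_of_nonneg (by positivity)]
    have : (a 1 0 : ℝ) ≤ C := by exact_mod_cast (by linarith : a 1 0 ≤ (C : ℤ))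
    have hQ1' : (y.den : ℝ) ≤ Q := by exact_mod_cast hQ1
    gcongr
    nlinarith
  · have h6 := Rat.den_dvd P Q
    rw [Rat.divInt_eq_div] at h6
    have := Int.le_of_dvd hQpos h6
    have := this.trans hQ2
    exact_mod_cast this

theorem exists_noncuspidal_rat_near {Γ : Subgroup SL(2, ℤ)} [Γ.FiniteIndex] {r : ℝ}
    {μ : Γ → Circle} {f : UpperHalfPlane → ℂ} (hf : IsModularFormOfWeight Γ r μ f)
    (hcusp : ¬ ∀ 𝔞 : OnePoint ℚ, IsCuspidalAt Γ r f 𝔞) :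
    ∃ C : ℕ, ∀ y : ℚ, ∃ y' : ℚ, ¬ IsCuspidalAt Γ r f (y' : OnePoint ℚ) ∧
      |(y : ℝ) - y'| ≤ C / (y.den : ℝ) ^ 2 ∧ y'.den ≤ C * y.den := by
  push Not at hcusp
  obtain ⟨𝔞, h𝔞⟩ := hcusp
  obtain ⟨δ, hδ⟩ : ∃ δ : SL(2, ℤ), Matrix.SpecialLinearGroup.mapGL ℚ δ •
      (OnePoint.infty : OnePoint ℚ) = 𝔞 := by
    unfold IsCuspidalAt at h𝔞
    push Not at h𝔞
    obtain ⟨δ, κ, a, h, -⟩ := h𝔞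
    exact ⟨δ, h.1.1⟩
  obtain ⟨C, hC⟩ := exists_orbit_rat_near Γ δ
  refine ⟨C, fun y ↦ ?_⟩
  obtain ⟨y', ⟨γ, hγ, h1⟩, h2, h3⟩ := hC y
  refine ⟨y', ?_, h2, h3⟩
  rw [← h1, map_mul, mul_smul, hδ]
  exact not_isCuspidalAt_smul hf h𝔞 hγ

/-! ### Counting rationals in a well-distributed set -/

theorem finite_setOf_rat_den_le (x ρ : ℝ) (n : ℕ) :
    {y : ℚ | |(y : ℝ) - x| ≤ ρ ∧ y.den ≤ n}.Finite := by
  obtain ⟨B, hB⟩ := exists_nat_ge ((|x| + ρ) * n)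
  refine Set.Finite.of_finite_image (f := fun y : ℚ ↦ (y.num, y.den))
    (((Set.finite_Icc (-B : ℤ) B).prod (Set.finite_Iic n)).subset ?_) ?_
  · rintro _ ⟨y, ⟨h1, h2⟩, rfl⟩
    refine ⟨abs_le.1 ?_, h2⟩
    have hy : (y : ℝ) * y.den = y.num := by exact_mod_cast Rat.mul_den_eq_num y
    have h3 : |(y : ℝ)| ≤ |x| + ρ := by
      have := abs_sub_abs_le_abs_sub (y : ℝ) x
      linarith
    have h4 : |(y.num : ℝ)| ≤ B := by
      rw [← hy, abs_mul, Nat.abs_cast]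
      refine le_trans ?_ hB
      have : (y.den : ℝ) ≤ n := by exact_mod_cast h2
      have := abs_nonneg (y : ℝ)
      gcongr
      linarith
    exact_mod_cast h4
  · intro y _ y' _ h
    simp only [Prod.mk.injEq] at h
    exact Rat.ext h.1 h.2

-- A denominator `q` admits at most `2qρ + 3` numerators, each with an interval of length `2/(nq)`;
-- the `3` produces the harmonic sum.
open Filter MeasureTheory Topology in
theorem measureReal_small_den_le {ρ : ℝ} (hρ : 0 < ρ) (x : ℝ) {n : ℕ} (hn : 0 < n) (m : ℕ) :
    (volume.real (⋃ q ∈ Finset.Icc 1 m, ⋃ p ∈ Finset.Icc ⌈(q : ℝ) * (x - ρ) - 1⌉ ⌊(q : ℝ) * (x + ρ) + 1⌋,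
      Metric.closedBall ((p : ℝ) / q) (1 / (n * q)))) ≤
    4 * ρ * m / n + 6 * (1 + Real.log m) / n := by
  have hn' : (0 : ℝ) < n := by exact_mod_cast hn
  calc _ ≤ ∑ q ∈ Finset.Icc 1 m, volume.real (⋃ p ∈ Finset.Icc ⌈(q : ℝ) * (x - ρ) - 1⌉ ⌊(q : ℝ) * (x + ρ) + 1⌋,
      Metric.closedBall ((p : ℝ) / q) (1 / (n * q))) := measureReal_biUnion_finset_le _ _
    _ ≤ ∑ q ∈ Finset.Icc 1 m, (4 * ρ / n + 6 / n * (q : ℝ)⁻¹) := by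
      refine Finset.sum_le_sum fun q hq ↦ ?_
      have hq1 : (0 : ℝ) < q := by
        have := (Finset.mem_Icc.1 hq).1
        exact_mod_cast this
      refine (measureReal_biUnion_finset_le _ _).trans ?_
      have : ∀ p : ℤ, volume.real (Metric.closedBall ((p : ℝ) / q) (1 / (n * q))) = 2 * (1 / (n * q)) :=
        fun p ↦ Real.volume_real_closedBall (by positivity)
      simp only [this, Finset.sum_const, nsmul_eq_mul, Int.card_Icc]
      have hcard : ((((⌊(q : ℝ) * (x + ρ) + 1⌋ + 1 - ⌈(q : ℝ) * (x - ρ) - 1⌉).toNat : ℕ)) : ℝ) ≤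
          2 * q * ρ + 3 := by
        have h1 := Int.floor_le ((q : ℝ) * (x + ρ) + 1)
        have h2 := Int.le_ceil ((q : ℝ) * (x - ρ) - 1)
        have h3 : ((((⌊(q : ℝ) * (x + ρ) + 1⌋ + 1 - ⌈(q : ℝ) * (x - ρ) - 1⌉).toNat : ℤ)) : ℝ) =
            ((max (⌊(q : ℝ) * (x + ρ) + 1⌋ + 1 - ⌈(q : ℝ) * (x - ρ) - 1⌉) 0 : ℤ) : ℝ) := by
          rw [Int.toNat_eq_max]
        rw [← Int.cast_natCast, h3]
        push_cast
        refine max_le (by linarith) (by positivity)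
      calc _ ≤ (2 * q * ρ + 3) * (2 * (1 / (n * q))) := by gcongr
        _ = _ := by field_simp; ring
    _ = 4 * ρ * m / n + 6 * (harmonic m : ℝ) / n := by
      rw [Finset.sum_add_distrib, ← Finset.mul_sum, harmonic_eq_sum_Icc]
      push_cast
      simp
      ring
    _ ≤ _ := by
      gcongr
      exact harmonic_le_one_add_log m

-- Dirichlet approximants of denominator at most `n/16` cover less than half of the interval. The
-- rest is covered by balls of radius `R n`, of order `1/n²`, around nearby members of `O`, so there
-- must be many of these.
open Filter MeasureTheory Topology in
theorem exists_card_ge_aux {O : Set ℚ} {C : ℕ} (hO : ∀ y : ℚ, ∃ y' ∈ O,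
      |(y : ℝ) - y'| ≤ C / (y.den : ℝ) ^ 2 ∧ y'.den ≤ C * y.den) {ρ : ℝ} (hρ : 0 < ρ) :
    ∀ᶠ n : ℕ in atTop, ∀ x : ℝ, ∃ F : Finset ℚ,
      (∀ y ∈ F, y ∈ O ∧ |(y : ℝ) - x| ≤ ρ ∧ y.den ≤ C * n) ∧
        ρ * n ^ 2 / (4 * (C * 16 ^ 2 + 16)) ≤ F.card := by
  set R : ℕ → ℝ := fun n ↦ (C * 16 ^ 2 + 16) / (n : ℝ) ^ 2 with hR
  have h1 : Tendsto R atTop (𝓝 0) :=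
    tendsto_const_nhds.div_atTop ((tendsto_pow_atTop two_ne_zero).comp tendsto_natCast_atTop_atTop)
  have h2 : Tendsto (fun n : ℕ ↦ 6 * (1 + Real.log n) / (n : ℝ)) atTop (𝓝 0) := by
    have a1 : Tendsto (fun n : ℕ ↦ 6 / (n : ℝ)) atTop (𝓝 0) :=
      tendsto_const_nhds.div_atTop tendsto_natCast_atTop_atTop
    have a2 : Tendsto (fun n : ℕ ↦ Real.log n / (n : ℝ)) atTop (𝓝 0) := by
      simpa [Function.comp_def] using (Real.tendsto_pow_log_div_mul_add_atTop 1 0 1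
        one_ne_zero).comp tendsto_natCast_atTop_atTop
    have a3 := a1.add (a2.const_mul 6)
    simp only [mul_zero, add_zero] at a3
    refine a3.congr fun n ↦ ?_
    ring
  filter_upwards [h1.eventually (gt_mem_nhds (half_pos hρ)),
    h2.eventually (gt_mem_nhds (show 0 < ρ / 4 by positivity)), eventually_gt_atTop 0]
    with n hn1 hn2 hn0 x
  have hn' : (0 : ℝ) < n := by exact_mod_cast hn0
  have hfin : {y : ℚ | y ∈ O ∧ |(y : ℝ) - x| ≤ ρ ∧ y.den ≤ C * n}.Finite :=
    (finite_setOf_rat_den_le x ρ (C * n)).subset fun y hy ↦ hy.2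
  refine ⟨hfin.toFinset, fun y hy ↦ hfin.mem_toFinset.1 hy, ?_⟩
  set F := hfin.toFinset with hF
  have hRpos : 0 < R n := by simp only [hR]; positivity
  -- Only the half-radius ball is covered: as `R n < ρ/2`, the members of `O` used stay within `ρ`
  -- of `x`.
  have hcover : Metric.closedBall x (ρ / 2) ⊆
      (⋃ q ∈ Finset.Icc 1 (n / 16), ⋃ p ∈ Finset.Icc ⌈(q : ℝ) * (x - ρ / 2) - 1⌉
        ⌊(q : ℝ) * (x + ρ / 2) + 1⌋, Metric.closedBall ((p : ℝ) / q) (1 / (n * q))) ∪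
      ⋃ y ∈ F, Metric.closedBall (y : ℝ) (R n) := by
    intro z hz
    rw [Metric.mem_closedBall, Real.dist_eq] at hz
    obtain ⟨y, hy1, hy2⟩ := Real.exists_rat_abs_sub_le_and_den_le z hn0
    have hyd : (0 : ℝ) < y.den := by exact_mod_cast y.pos
    have hy3 : |z - y| ≤ 1 / (n * y.den) := by
      refine hy1.trans ?_
      gcongr
      linarith
    by_cases hc : y.den ≤ n / 16
    · left
      simp only [Set.mem_iUnion, Finset.mem_Icc]
      have hy : (y : ℝ) = y.num / y.den := Rat.cast_def y
      have hyq : (y : ℝ) * y.den = y.num := by exact_mod_cast Rat.mul_den_eq_num y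
      have h4 : |z * y.den - y.num| ≤ 1 := by
        rw [← hyq, ← sub_mul, abs_mul, Nat.abs_cast]
        have hn1' : (1 : ℝ) ≤ n := by exact_mod_cast hn0
        calc _ ≤ 1 / (n * y.den) * (y.den : ℝ) := by gcongr
          _ = 1 / n := by field_simp
          _ ≤ 1 := by rw [div_le_one hn']; exact hn1'
      have h5 := abs_le.1 h4
      have h6 := abs_le.1 hz
      refine ⟨y.den, ⟨y.pos, hc⟩, y.num, ⟨Int.ceil_le.2 ?_, Int.le_floor.2 ?_⟩, ?_⟩
      · nlinarith [mul_le_mul_of_nonneg_left h6.1 hyd.le]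
      · nlinarith [mul_le_mul_of_nonneg_left h6.2 hyd.le]
      · rw [Metric.mem_closedBall, Real.dist_eq, ← hy]
        exact hy3
    · right
      obtain ⟨y', hO', h3, h4⟩ := hO y
      have hc' : (n : ℝ) ≤ 16 * y.den := by
        have : n ≤ 16 * y.den := by omega
        exact_mod_cast this
      have h5 : |z - y| ≤ 16 / (n : ℝ) ^ 2 := by
        refine hy3.trans ?_
        rw [div_le_div_iff₀ (by positivity) (by positivity)]
        nlinarith
      have h6 : |(y : ℝ) - y'| ≤ C * 16 ^ 2 / (n : ℝ) ^ 2 := by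
        refine h3.trans ?_
        rw [div_le_div_iff₀ (by positivity) (by positivity), mul_assoc, ← mul_pow]
        gcongr
      have h7 : |z - y'| ≤ R n := by
        have := abs_sub_le z y y'
        simp only [hR]
        rw [add_div]
        linarith
      simp only [Set.mem_iUnion]
      refine ⟨y', ?_, by rwa [Metric.mem_closedBall, Real.dist_eq]⟩
      rw [hF, Set.Finite.mem_toFinset]
      refine ⟨hO', ?_, h4.trans (by gcongr)⟩
      have := abs_sub_le (y' : ℝ) z x
      rw [abs_sub_comm] at h7
      linarith
  have hm := measureReal_mono (μ := volume) hcover (by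
    refine ((Bornology.isBounded_biUnion_finset _).2 fun q _ ↦
      (Bornology.isBounded_biUnion_finset _).2 fun p _ ↦ Metric.isBounded_closedBall).union
      ((Bornology.isBounded_biUnion_finset _).2 fun p _ ↦ Metric.isBounded_closedBall)
      |>.measure_lt_top.ne)
  rw [Real.volume_real_closedBall (by positivity)] at hm
  have h5 := measureReal_union_le (μ := volume) (⋃ q ∈ Finset.Icc 1 (n / 16), ⋃ p ∈ Finset.Icc ⌈(q : ℝ) * (x - ρ / 2) - 1⌉
        ⌊(q : ℝ) * (x + ρ / 2) + 1⌋, Metric.closedBall ((p : ℝ) / q) (1 / (n * q))) (⋃ y ∈ F, Metric.closedBall (y : ℝ) (R n))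
  have h6 := measureReal_small_den_le (half_pos hρ) x hn0 (n / 16)
  have h7 : volume.real (⋃ y ∈ F, Metric.closedBall (y : ℝ) (R n)) ≤ F.card * (2 * R n) := by
    refine (measureReal_biUnion_finset_le _ _).trans ?_
    simp [Real.volume_real_closedBall hRpos.le]
  have h8 : ((n / 16 : ℕ) : ℝ) ≤ n / 16 := Nat.cast_div_le
  have h9 : 4 * (ρ / 2) * ((n / 16 : ℕ) : ℝ) / n ≤ ρ / 8 := by
    rw [div_le_iff₀ hn']
    nlinarith
  have h10 : 6 * (1 + Real.log ((n / 16 : ℕ) : ℝ)) / n ≤ 6 * (1 + Real.log n) / n := by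
    rcases Nat.eq_zero_or_pos (n / 16) with h0 | h0
    · rw [h0]
      have : 0 ≤ Real.log n := Real.log_natCast_nonneg n
      simp only [Nat.cast_zero, Real.log_zero]
      gcongr
    · have : (0 : ℝ) < (n / 16 : ℕ) := by exact_mod_cast h0
      gcongr
      exact Nat.div_le_self _ _
  have h11 : ρ / 2 ≤ F.card * (2 * R n) := by linarith
  simp only [hR] at h11
  rw [div_le_iff₀ (by positivity)]
  have : (F.card : ℝ) * (2 * ((C * 16 ^ 2 + 16) / (n : ℝ) ^ 2)) * (2 * (n : ℝ) ^ 2) =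
    F.card * (4 * (C * 16 ^ 2 + 16)) := by field_simp; ring
  rw [← this]
  calc ρ * (n : ℝ) ^ 2 = ρ / 2 * (2 * (n : ℝ) ^ 2) := by ring
    _ ≤ _ := by gcongr

open Filter in
theorem exists_card_ge {O : Set ℚ} {C : ℕ} (hO : ∀ y : ℚ, ∃ y' ∈ O,
      |(y : ℝ) - y'| ≤ C / (y.den : ℝ) ^ 2 ∧ y'.den ≤ C * y.den) :
    ∃ c : ℝ, 0 < c ∧ ∀ ρ > 0, ∀ᶠ Q : ℕ in atTop, ∀ x : ℝ, ∃ F : Finset ℚ,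
      (∀ y ∈ F, y ∈ O ∧ |(y : ℝ) - x| ≤ ρ ∧ y.den ≤ Q) ∧ c * ρ * Q ^ 2 ≤ F.card := by
  have hC : 0 < C := by
    obtain ⟨y', -, -, h⟩ := hO 0
    by_contra! hC
    have := y'.pos
    simp [Nat.le_zero.1 hC] at h
  refine ⟨1 / ((2 * C) ^ 2 * (4 * (C * 16 ^ 2 + 16))), by positivity, fun ρ hρ ↦ ?_⟩
  -- The previous bound is applied with `n = Q / C`, so that denominators `C n` are at most `Q`; the
  -- rounding costs a factor `2C`.
  filter_upwards [(Nat.tendsto_div_const_atTop hC.ne').eventually (exists_card_ge_aux hO hρ),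
    eventually_ge_atTop C] with Q hQ hQC x
  obtain ⟨F, hF, hcard⟩ := hQ x
  refine ⟨F, fun y hy ↦ ⟨(hF y hy).1, (hF y hy).2.1,
    (hF y hy).2.2.trans (Nat.mul_div_le Q C)⟩, le_trans ?_ hcard⟩
  have h1 : (Q : ℝ) ≤ 2 * C * (Q / C : ℕ) := by
    have h2 : Q < C * (Q / C) + C := by
      have := Nat.lt_mul_div_succ Q hC
      linarith
    have h3 : 1 ≤ Q / C := (Nat.one_le_div_iff hC).2 hQC
    have : Q ≤ 2 * C * (Q / C) := by nlinarith
    exact_mod_cast this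
  have hC' : (0 : ℝ) < C := by exact_mod_cast hC
  rw [div_mul_eq_mul_div, div_mul_eq_mul_div, div_le_div_iff₀ (by positivity) (by positivity)]
  have h4 : (Q : ℝ) ^ 2 ≤ (2 * C * (Q / C : ℕ)) ^ 2 := by gcongr
  calc _ = ρ * (4 * (C * 16 ^ 2 + 16)) * (Q : ℝ) ^ 2 := by ring
    _ ≤ ρ * (4 * (C * 16 ^ 2 + 16)) * (2 * C * (Q / C : ℕ)) ^ 2 := by gcongr
    _ = _ := by ring

/-! ### Upper bound for the dimension of sets of well-approximable numbers -/

-- Denominator `k` contributes `O(k)` intervals of diameter `O(k ^ (-t))`, so the covers are bounded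
-- by tails of `∑ k ^ (1 - t * s)`.
open Filter MeasureTheory Topology in
theorem hausdorffMeasure_approximable_bounded {t s : ℝ} (ht : 0 < t) (hs0 : 0 < s) (hs : 2 < t * s) (m : ℕ) :
    μH[s] {x : ℝ | |x| ≤ m ∧ {y : ℚ | |x - y| ≤ m / (y.den : ℝ) ^ t}.Infinite} = 0 := by
  set δ : ℕ → ℝ := fun k ↦ m / (k : ℝ) ^ t with hδ
  have hδ0 : ∀ k, 0 ≤ δ k := fun k ↦ by positivity
  set g : ℕ → ℝ := fun k ↦ (4 * m + 1) * (2 * m) ^ s * (k : ℝ) ^ (1 - t * s) with hg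
  have hg0 : ∀ k, 0 ≤ g k := fun k ↦ by positivity
  have hgs : Summable g := (Real.summable_nat_rpow.2 (by linarith)).mul_left _
  -- The index `q` stands for the denominator `q + (n + 1)`; fractions need not be reduced.
  let ι : ℕ → Type := fun n ↦ Σ q : ℕ, Finset.Icc (-((2 * m * (q + (n + 1)) : ℕ) : ℤ)) ((2 * m * (q + (n + 1)) : ℕ) : ℤ)
  let T : (n : ℕ) → ι n → Set ℝ := fun n i ↦
    Set.Icc ((i.2 : ℤ) / ((i.1 + (n + 1) : ℕ) : ℝ) - δ (i.1 + (n + 1)))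
      ((i.2 : ℤ) / ((i.1 + (n + 1) : ℕ) : ℝ) + δ (i.1 + (n + 1)))
  have hdiam : ∀ n i, Metric.ediam (T n i) = ENNReal.ofReal (2 * δ (i.1 + (n + 1))) := fun n i ↦ by
    rw [Real.ediam_Icc]
    congr 1
    ring
  have hδlim : Tendsto (fun n : ℕ ↦ ENNReal.ofReal (2 * δ (n + 1))) atTop (𝓝 0) := by
    rw [← ENNReal.ofReal_zero]
    refine ENNReal.tendsto_ofReal ?_
    have : Tendsto δ atTop (𝓝 0) :=
      tendsto_const_nhds.div_atTop ((tendsto_rpow_atTop ht).comp tendsto_natCast_atTop_atTop)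
    simpa using ((this.comp (tendsto_add_atTop_nat 1)).const_mul 2)
  have hle := Measure.hausdorffMeasure_le_liminf_tsum (X := ℝ) s
    {x : ℝ | |x| ≤ m ∧ {y : ℚ | |x - y| ≤ m / (y.den : ℝ) ^ t}.Infinite} (l := atTop)
    _ hδlim T (Eventually.of_forall fun n i ↦ ?_) (Eventually.of_forall fun n x hx ↦ ?_)
  · refine le_antisymm (hle.trans ?_) zero_le
    have hb : ∀ n, ∑' i : ι n, Metric.ediam (T n i) ^ s ≤ ENNReal.ofReal (∑' q, g (q + (n + 1))) := by
      intro n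
      rw [ENNReal.ofReal_tsum_of_nonneg (fun q ↦ hg0 _) ((summable_nat_add_iff (n + 1)).2 hgs)]
      rw [ENNReal.tsum_sigma']
      refine ENNReal.tsum_le_tsum fun q ↦ ?_
      simp only [hdiam, tsum_fintype, Finset.sum_const, nsmul_eq_mul]
      set k := q + (n + 1) with hk
      have hk0 : (1 : ℝ) ≤ k := by
        have : 1 ≤ k := by omega
        exact_mod_cast this
      have hcard : Finset.card (Finset.univ : Finset (Finset.Icc (-((2 * m * k : ℕ) : ℤ)) ((2 * m * k : ℕ) : ℤ)))
          = 4 * m * k + 1 := by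
        rw [Finset.card_univ, Fintype.card_coe, Int.card_Icc]
        have : ((2 * m * k : ℕ) : ℤ) + 1 - -((2 * m * k : ℕ) : ℤ) = ((4 * m * k + 1 : ℕ) : ℤ) := by
          push_cast; ring
        rw [this, Int.toNat_natCast]
      rw [hcard, ENNReal.ofReal_rpow_of_nonneg (by have := hδ0 k; positivity) hs0.le,
        ← ENNReal.ofReal_natCast, ← ENNReal.ofReal_mul (by positivity)]
      refine ENNReal.ofReal_le_ofReal ?_
      have e1 : (2 * δ k) ^ s = (2 * m) ^ s * (k : ℝ) ^ (-(t * s)) := by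
        simp only [hδ]
        rw [← mul_div_assoc, Real.div_rpow (by positivity) (by positivity), ← Real.rpow_mul (by positivity),
          Real.rpow_neg (by positivity), div_eq_mul_inv]
      have e2 : (k : ℝ) ^ (1 - t * s) = k * (k : ℝ) ^ (-(t * s)) := by
        rw [sub_eq_add_neg, Real.rpow_add (by positivity), Real.rpow_one]
      rw [e1]
      simp only [hg, e2]
      push_cast
      calc (4 * m * (k : ℝ) + 1) * ((2 * m) ^ s * (k : ℝ) ^ (-(t * s)))
          ≤ ((4 * m + 1) * (k : ℝ)) * ((2 * m) ^ s * (k : ℝ) ^ (-(t * s))) := by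
            gcongr
            linarith
        _ = _ := by ring
    have hlim : Tendsto (fun n ↦ ENNReal.ofReal (∑' q, g (q + (n + 1)))) atTop (𝓝 0) := by
      rw [← ENNReal.ofReal_zero]
      exact ENNReal.tendsto_ofReal ((tendsto_sum_nat_add g).comp (tendsto_add_atTop_nat 1))
    rw [← hlim.liminf_eq]
    exact liminf_le_liminf (Eventually.of_forall hb)
  · rw [hdiam]
    refine ENNReal.ofReal_le_ofReal ?_
    have hle : ((n + 1 : ℕ) : ℝ) ≤ (i.1 + (n + 1) : ℕ) := by exact_mod_cast Nat.le_add_left _ _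
    exact mul_le_mul_of_nonneg_left (div_le_div_of_nonneg_left (by positivity) (by positivity)
      (Real.rpow_le_rpow (by positivity) hle ht.le)) two_pos.le
  · obtain ⟨hx1, hx2⟩ := hx
    have : ∃ y : ℚ, |x - y| ≤ m / (y.den : ℝ) ^ t ∧ n < y.den := by
      by_contra! hcon
      refine hx2 ((finite_setOf_rat_den_le x m n).subset fun y hy ↦ ⟨?_, hcon y hy⟩)
      rw [abs_sub_comm]
      refine hy.trans (div_le_self (by positivity) (Real.one_le_rpow ?_ ht.le))
      exact_mod_cast y.pos
    obtain ⟨y, hy1, hy2⟩ := this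
    have hd : (1 : ℝ) ≤ y.den := by exact_mod_cast y.pos
    have hyx : |(y : ℝ)| ≤ 2 * m := by
      have h1 : m / (y.den : ℝ) ^ t ≤ m := div_le_self (by positivity) (Real.one_le_rpow hd ht.le)
      have h2 := abs_sub_abs_le_abs_sub (y : ℝ) x
      rw [abs_sub_comm] at h2
      linarith
    obtain ⟨q, hq⟩ : ∃ q, y.den = q + (n + 1) := ⟨y.den - (n + 1), by omega⟩
    have hnum : |y.num| ≤ ((2 * m * (q + (n + 1)) : ℕ) : ℤ) := by
      have hyq : (y : ℝ) * y.den = y.num := by exact_mod_cast Rat.mul_den_eq_num y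
      have : |(y.num : ℝ)| ≤ 2 * m * y.den := by
        rw [← hyq, abs_mul, Nat.abs_cast]
        gcongr
      rw [← hq]
      exact_mod_cast this
    refine Set.mem_iUnion.2 ⟨⟨q, y.num, Finset.mem_Icc.2 (abs_le.1 hnum)⟩, ?_⟩
    have hy : (y : ℝ) = y.num / y.den := Rat.cast_def y
    simp only [T]
    rw [← hq, ← hy]
    have := abs_le.1 hy1
    simp only [hδ]
    constructor <;> linarith

open MeasureTheory in
theorem hausdorffMeasure_approximable {t s : ℝ} (ht : 0 < t) (hs0 : 0 < s) (hs : 2 < t * s) :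
    μH[s] {x : ℝ | ∃ C : ℝ, {y : ℚ | |x - y| ≤ C / (y.den : ℝ) ^ t}.Infinite} = 0 := by
  refine measure_mono_null (t := ⋃ m : ℕ, {x : ℝ | |x| ≤ m ∧
    {y : ℚ | |x - y| ≤ m / (y.den : ℝ) ^ t}.Infinite}) ?_
    (measure_iUnion_null fun m ↦ hausdorffMeasure_approximable_bounded ht hs0 hs m)
  rintro x ⟨C, hC⟩
  obtain ⟨m, hm⟩ := exists_nat_ge (max |x| C)
  refine Set.mem_iUnion.2 ⟨m, (le_max_left _ _).trans hm, hC.mono fun y hy ↦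
    le_trans (b := C / (y.den : ℝ) ^ t) hy ?_⟩
  have := (le_max_right |x| C).trans hm
  gcongr

/-! ### A Cantor measure on well-approximable numbers -/

/-- A tree of rationals in `O`: `sel k y` lists the children, of denominator at most `Q (k + 1)`,
of a rational `y` at level `k`. -/
structure RatTree (O : Set ℚ) (τ c : ℝ) where
  Q : ℕ → ℕ
  n : ℕ → ℕ
  sel : (k : ℕ) → ℚ → Fin (n k + 1) → ℚ
  Q_pos : ∀ k, 0 < Q k
  two_mul_Q_le : ∀ k, 2 * Q k ≤ Q (k + 1)
  -- The exponent `k` makes `Q k ^ τ / c` eventually smaller than any fixed positive power of `Q (k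
  -- + 1)`.
  growth : ∀ k, ((Q k : ℝ) ^ τ / c) ^ k ≤ Q (k + 1)
  le_n : ∀ k, c * (Q (k + 1) : ℝ) ^ 2 / (Q k : ℝ) ^ τ ≤ n k + 1
  sel_injective : ∀ k y, Function.Injective (sel k y)
  sel_mem : ∀ k y i, sel k y i ∈ O
  abs_sel_sub_le : ∀ k y i, |(sel k y i : ℝ) - y| ≤ 1 / (16 * (Q k : ℝ) ^ τ)
  den_sel_le : ∀ k y i, (sel k y i).den ≤ Q (k + 1)

-- All nodes of a level share the next denominator bound and the number of children. This is
-- possible because the threshold for `Q` depends on `ρ` but not on `x`; `c / 16` comes from `ρ = 1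
-- / (16 * Q k ^ τ)`.
open Filter Topology in
theorem exists_ratTree {O : Set ℚ} {c τ : ℝ} (hc : 0 < c)
    (hO : ∀ ρ > 0, ∀ᶠ Q : ℕ in atTop, ∀ x : ℝ, ∃ F : Finset ℚ,
      (∀ y ∈ F, y ∈ O ∧ |(y : ℝ) - x| ≤ ρ ∧ y.den ≤ Q) ∧ c * ρ * Q ^ 2 ≤ F.card) :
    Nonempty (RatTree O τ (c / 16)) := by
  have h1 : ∀ k q : ℕ, ∃ q' : ℕ, 0 < q → 2 * q ≤ q' ∧ ((q : ℝ) ^ τ / (c / 16)) ^ k ≤ q' ∧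
      ∀ x : ℝ, ∃ F : Finset ℚ,
      (∀ y ∈ F, y ∈ O ∧ |(y : ℝ) - x| ≤ 1 / (16 * (q : ℝ) ^ τ) ∧ y.den ≤ q') ∧
        c * (1 / (16 * (q : ℝ) ^ τ)) * q' ^ 2 ≤ F.card := by
    intro k q
    by_cases hq : 0 < q
    · have hq' : (0 : ℝ) < q := by exact_mod_cast hq
      obtain ⟨q', h⟩ := ((eventually_ge_atTop (2 * q)).and
        ((tendsto_natCast_atTop_atTop.eventually_ge_atTop (((q : ℝ) ^ τ / (c / 16)) ^ k)).and
        (hO (1 / (16 * (q : ℝ) ^ τ)) (by positivity)))).exists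
      exact ⟨q', fun _ ↦ h⟩
    · exact ⟨0, fun h ↦ absurd h hq⟩
  choose next hnext using h1
  obtain ⟨Q, hQ1, hQsucc⟩ : ∃ Q : ℕ → ℕ, Q 0 = 1 ∧ ∀ k, Q (k + 1) = next k (Q k) :=
    ⟨fun k ↦ Nat.rec 1 (fun k q ↦ next k q) k, rfl, fun _ ↦ rfl⟩
  have hQ0 : ∀ k, 0 < Q k := by
    intro k
    induction k with
    | zero => rw [hQ1]; exact one_pos
    | succ k ih =>
      have := (hnext k (Q k) ih).1
      rw [← hQsucc] at this
      omega
  have hQ := fun k ↦ hnext k (Q k) (hQ0 k)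
  simp only [← hQsucc] at hQ
  let n : ℕ → ℕ := fun k ↦ ⌈c * (1 / (16 * (Q k : ℝ) ^ τ)) * (Q (k + 1) : ℝ) ^ 2⌉₊ - 1
  have hn : ∀ k, n k + 1 = ⌈c * (1 / (16 * (Q k : ℝ) ^ τ)) * (Q (k + 1) : ℝ) ^ 2⌉₊ := by
    intro k
    have h2 : (0 : ℝ) < Q k := by exact_mod_cast hQ0 k
    have h3 : (0 : ℝ) < Q (k + 1) := by exact_mod_cast hQ0 (k + 1)
    exact Nat.sub_add_cancel (Nat.ceil_pos.2 (by positivity))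
  have hsel : ∀ (k : ℕ) (y : ℚ), ∃ s : Fin (n k + 1) → ℚ, Function.Injective s ∧ ∀ i, s i ∈ O ∧
      |(s i : ℝ) - y| ≤ 1 / (16 * (Q k : ℝ) ^ τ) ∧ (s i).den ≤ Q (k + 1) := by
    intro k y
    obtain ⟨F, hF, hcard⟩ := (hQ k).2.2 y
    have hle : n k + 1 ≤ F.card := by
      rw [hn]
      exact Nat.ceil_le.2 hcard
    refine ⟨fun i ↦ F.equivFin.symm (Fin.castLE hle i), ?_, fun i ↦ hF _ (Subtype.prop _)⟩
    exact Subtype.val_injective.comp (F.equivFin.symm.injective.comp (Fin.castLE_injective hle))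
  choose sel hsel1 hsel2 using hsel
  refine ⟨⟨Q, n, sel, hQ0, fun k ↦ (hQ k).1, fun k ↦ (hQ k).2.1, fun k ↦ ?_, hsel1,
    fun k y i ↦ (hsel2 k y i).1, fun k y i ↦ (hsel2 k y i).2.1, fun k y i ↦ (hsel2 k y i).2.2⟩⟩
  have := Nat.le_ceil (c * (1 / (16 * (Q k : ℝ) ^ τ)) * (Q (k + 1) : ℝ) ^ 2)
  rw [← hn] at this
  push_cast at this
  refine le_trans (le_of_eq ?_) this
  have h2 : (0 : ℝ) < Q k := by exact_mod_cast hQ0 k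
  field_simp

namespace RatTree

variable {O : Set ℚ} {τ c : ℝ} (T : RatTree O τ c)

/-- The rational at level `k` of the branch `ω`. -/
def center : ℕ → (∀ k, Fin (T.n k + 1)) → ℚ
  | 0, _ => 0
  | k + 1, ω => T.sel k (center k ω) (ω k)

/-- The radius of the intervals at level `k`. -/
noncomputable def radius (k : ℕ) : ℝ := 1 / (8 * (T.Q k : ℝ) ^ τ)

theorem Q_cast_pos (k : ℕ) : (0 : ℝ) < T.Q k := by exact_mod_cast T.Q_pos k

theorem radius_pos (k : ℕ) : 0 < T.radius k := by
  have := T.Q_cast_pos k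
  unfold radius
  positivity

theorem radius_succ_le (hτ : 2 ≤ τ) (k : ℕ) : T.radius (k + 1) ≤ T.radius k / 2 := by
  have h0 := T.Q_cast_pos k
  have h1 : (2 : ℝ) * T.Q k ≤ T.Q (k + 1) := by exact_mod_cast T.two_mul_Q_le k
  have h2 : (2 : ℝ) * (T.Q k : ℝ) ^ τ ≤ (T.Q (k + 1) : ℝ) ^ τ := by
    calc (2 : ℝ) * (T.Q k : ℝ) ^ τ ≤ 2 ^ τ * (T.Q k : ℝ) ^ τ := by
          gcongr
          exact Real.self_le_rpow_of_one_le one_le_two (by linarith)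
      _ = (2 * (T.Q k : ℝ)) ^ τ := (Real.mul_rpow (by positivity) (by positivity)).symm
      _ ≤ _ := by gcongr
  unfold radius
  rw [div_div]
  apply one_div_le_one_div_of_le (by positivity)
  linarith

theorem radius_add_le (hτ : 2 ≤ τ) (k j : ℕ) : T.radius (k + j) ≤ T.radius k / 2 ^ j := by
  induction j with
  | zero => simp
  | succ j ih =>
    refine (T.radius_succ_le hτ (k + j)).trans ?_
    rw [pow_succ, ← div_div]
    linarith

theorem dist_center_succ_le (k : ℕ) (ω : ∀ k, Fin (T.n k + 1)) :
    dist (T.center k ω : ℝ) (T.center (k + 1) ω) ≤ T.radius k / 2 := by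
  rw [dist_comm, Real.dist_eq]
  refine (T.abs_sel_sub_le k _ _).trans (le_of_eq ?_)
  unfold radius
  have := T.Q_cast_pos k
  field_simp
  norm_num

open Filter Topology in
theorem exists_tendsto_center (hτ : 2 ≤ τ) (ω : ∀ k, Fin (T.n k + 1)) :
    ∃ x : ℝ, Tendsto (fun k ↦ (T.center k ω : ℝ)) atTop (𝓝 x) := by
  refine cauchySeq_tendsto_of_complete (cauchySeq_of_le_geometric_two (C := T.radius 0) fun k ↦ ?_)
  refine (T.dist_center_succ_le k ω).trans ?_
  have := T.radius_add_le hτ 0 k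
  rw [zero_add] at this
  rw [div_right_comm]
  linarith

open Filter Topology in
/-- The limit point of the branch `ω`. -/
noncomputable def point (ω : ∀ k, Fin (T.n k + 1)) : ℝ := limUnder atTop fun k ↦ (T.center k ω : ℝ)

open Filter Topology in
theorem tendsto_center (hτ : 2 ≤ τ) (ω : ∀ k, Fin (T.n k + 1)) :
    Tendsto (fun k ↦ (T.center k ω : ℝ)) atTop (𝓝 (T.point ω)) :=
  tendsto_nhds_limUnder (T.exists_tendsto_center hτ ω)

/-- Steps are at most half the radius and radii at least halve, so the remaining steps sum to at
most `radius k`. -/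
theorem abs_center_sub_point_le (hτ : 2 ≤ τ) (k : ℕ) (ω : ∀ k, Fin (T.n k + 1)) :
    |(T.center k ω : ℝ) - T.point ω| ≤ T.radius k := by
  rw [← Real.dist_eq]
  refine dist_le_of_le_geometric_two_of_tendsto₀ (f := fun j ↦ (T.center (k + j) ω : ℝ))
    (a := T.point ω) (C := T.radius k) (fun j ↦ ?_) ?_
  · refine (T.dist_center_succ_le (k + j) ω).trans ?_
    have := T.radius_add_le hτ k j
    rw [div_right_comm]
    linarith
  · have := (T.tendsto_center hτ ω).comp (Filter.tendsto_add_atTop_nat k)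
    refine this.congr fun j ↦ ?_
    simp [add_comm]

theorem center_congr {k : ℕ} {ω ω' : ∀ k, Fin (T.n k + 1)} (h : ∀ j < k, ω j = ω' j) :
    T.center k ω = T.center k ω' := by
  induction k with
  | zero => rfl
  | succ k ih =>
    simp only [center]
    rw [ih fun j hj ↦ h j (by omega), h k (by omega)]

/-- Points of branches that part at level `k` are at least this far apart. -/
noncomputable def gap (k : ℕ) : ℝ := 1 / (2 * (T.Q (k + 1) : ℝ) ^ 2)

theorem gap_pos (k : ℕ) : 0 < T.gap k := by
  have := T.Q_cast_pos (k + 1)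
  unfold gap
  positivity

theorem gap_succ_le (k : ℕ) : T.gap (k + 1) ≤ T.gap k / 2 := by
  have h0 := T.Q_cast_pos (k + 1)
  have h1 : (2 : ℝ) * T.Q (k + 1) ≤ T.Q (k + 1 + 1) := by exact_mod_cast T.two_mul_Q_le (k + 1)
  unfold gap
  rw [div_div]
  apply one_div_le_one_div_of_le (by positivity)
  nlinarith

theorem gap_antitone : Antitone T.gap :=
  antitone_nat_of_succ_le fun k ↦ (T.gap_succ_le k).trans (by linarith [T.gap_pos k])

open Filter Topology in
theorem tendsto_gap : Tendsto T.gap atTop (𝓝 0) := by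
  have h : ∀ k, T.gap k ≤ T.gap 0 * (1 / 2) ^ k := by
    intro k
    induction k with
    | zero => simp
    | succ k ih =>
      refine (T.gap_succ_le k).trans ?_
      rw [pow_succ]
      linarith
  refine squeeze_zero (fun k ↦ (T.gap_pos k).le) h ?_
  simpa using (tendsto_pow_atTop_nhds_zero_of_lt_one (by norm_num : (0 : ℝ) ≤ 1 / 2)
    (by norm_num)).const_mul (T.gap 0)

theorem _root_.Rat.one_div_sq_le_abs_sub {y y' : ℚ} (h : y ≠ y') {q : ℕ} (hy : y.den ≤ q)
    (hy' : y'.den ≤ q) : 1 / (q : ℝ) ^ 2 ≤ |(y : ℝ) - y'| := by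
  have hd : (0 : ℝ) < y.den := by exact_mod_cast y.pos
  have hd' : (0 : ℝ) < y'.den := by exact_mod_cast y'.pos
  have h1 : (y.den : ℝ) ≤ q := by exact_mod_cast hy
  have h2 : (y'.den : ℝ) ≤ q := by exact_mod_cast hy'
  have h3 : ((y : ℝ) - y') * (y.den * y'.den) = ((y.num * y'.den - y'.num * y.den : ℤ) : ℝ) := by
    have e1 : (y : ℝ) * y.den = y.num := by exact_mod_cast Rat.mul_den_eq_num y
    have e2 : (y' : ℝ) * y'.den = y'.num := by exact_mod_cast Rat.mul_den_eq_num y'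
    push_cast
    linear_combination (y'.den : ℝ) * e1 - (y.den : ℝ) * e2
  have h4 : y.num * y'.den - y'.num * y.den ≠ 0 := by
    intro h0
    rw [h0, Int.cast_zero] at h3
    have h5 : (y : ℝ) - y' = 0 := by
      rcases mul_eq_zero.1 h3 with h5 | h5
      · exact h5
      · exact absurd h5 (by positivity)
    exact h (by exact_mod_cast sub_eq_zero.1 h5)
  have h5 : (1 : ℝ) ≤ |(y : ℝ) - y'| * (y.den * y'.den) := by
    have h6 := congrArg abs h3
    rw [abs_mul, abs_of_pos (mul_pos hd hd')] at h6
    rw [h6]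
    exact_mod_cast Int.one_le_abs h4
  have hq : (0 : ℝ) < q := hd.trans_le h1
  rw [div_le_iff₀ (by positivity)]
  refine h5.trans ?_
  rw [sq]
  gcongr

/-- Distinct centers are at least `1/Q²` apart, where `Q` is `Q (k + 1)`. Since `τ ≥ 2`, each limit
point is within `1/(8Q²)` of its center. -/
theorem gap_le_abs_sub (hτ : 2 ≤ τ) {k : ℕ} {ω ω' : ∀ k, Fin (T.n k + 1)}
    (h : ∀ j < k, ω j = ω' j) (hne : ω k ≠ ω' k) : T.gap k ≤ |T.point ω - T.point ω'| := by
  have h1 : T.center (k + 1) ω ≠ T.center (k + 1) ω' := by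
    simp only [center, T.center_congr h]
    exact fun h2 ↦ hne (T.sel_injective _ _ h2)
  have h2 := Rat.one_div_sq_le_abs_sub h1 (T.den_sel_le k _ _) (T.den_sel_le k _ _)
  have h3 := T.abs_center_sub_point_le hτ (k + 1) ω
  have h4 := T.abs_center_sub_point_le hτ (k + 1) ω'
  have h5 : T.radius (k + 1) ≤ 1 / (8 * (T.Q (k + 1) : ℝ) ^ 2) := by
    have h0 := T.Q_cast_pos (k + 1)
    have h6 : (1 : ℝ) ≤ T.Q (k + 1) := by exact_mod_cast T.Q_pos (k + 1)
    unfold radius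
    apply one_div_le_one_div_of_le (by positivity)
    have := Real.rpow_le_rpow_of_exponent_le h6 hτ
    rw [Real.rpow_two] at this
    linarith
  have h6 : T.gap k = 1 / (T.Q (k + 1) : ℝ) ^ 2 * (1 / 2) := by
    unfold gap; rw [one_div_mul_one_div, mul_comm]
  have h7 : 1 / (8 * (T.Q (k + 1) : ℝ) ^ 2) = 1 / (T.Q (k + 1) : ℝ) ^ 2 * (1 / 8) := by
    rw [one_div_mul_one_div, mul_comm]
  have h8 := abs_sub_le (T.center (k + 1) ω : ℝ) (T.point ω) (T.center (k + 1) ω')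
  have h9 := abs_sub_le (T.point ω) (T.point ω') (T.center (k + 1) ω' : ℝ)
  rw [abs_sub_comm (T.point ω')] at h9
  have h10 : 0 ≤ 1 / (T.Q (k + 1) : ℝ) ^ 2 := by positivity
  linarith

theorem agree_of_abs_sub_lt (hτ : 2 ≤ τ) {k : ℕ} {ω ω' : ∀ k, Fin (T.n k + 1)}
    (h : ∀ j < k, |T.point ω - T.point ω'| < T.gap j) : ∀ j < k, ω j = ω' j := by
  intro j
  induction j using Nat.strong_induction_on with
  | _ j ih =>
    intro hj
    by_contra hne
    exact (h j hj).not_ge (T.gap_le_abs_sub hτ (fun i hi ↦ ih i hi (hi.trans hj)) hne)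

open MeasureTheory in
theorem measurable_center (k : ℕ) : Measurable (T.center k) := by
  induction k with
  | zero => exact measurable_const
  | succ k ih =>
    have : T.center (k + 1) = (fun p : ℚ × Fin (T.n k + 1) ↦ T.sel k p.1 p.2) ∘
        fun ω ↦ (T.center k ω, ω k) := rfl
    rw [this]
    exact (measurable_of_countable _).comp (ih.prodMk (measurable_pi_apply k))

theorem measurable_point (hτ : 2 ≤ τ) : Measurable T.point := by
  refine measurable_of_tendsto_metrizable (f := fun k ω ↦ (T.center k ω : ℝ)) (fun k ↦ ?_)
    (tendsto_pi_nhds.2 fun ω ↦ T.tendsto_center hτ ω)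
  exact (measurable_of_countable ((↑) : ℚ → ℝ)).comp (T.measurable_center k)

open MeasureTheory in
/-- The measure on branches that is uniform at each level. -/
noncomputable def branchMeasure : Measure (∀ k, Fin (T.n k + 1)) :=
  Measure.infinitePi fun _ ↦ ProbabilityTheory.uniformOn Set.univ

open MeasureTheory in
instance : IsProbabilityMeasure T.branchMeasure := by
  unfold branchMeasure
  infer_instance

/-- `B`, which need not be measurable, sits in a cylinder with one choice per level below `k` and
`A` at level `k`. -/
theorem branchMeasure_le (k : ℕ) (B : Set (∀ k, Fin (T.n k + 1)))
    (hB : ∀ ω ∈ B, ∀ ω' ∈ B, ∀ j < k, ω j = ω' j) (A : Finset (Fin (T.n k + 1)))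
    (hA : ∀ ω ∈ B, ω k ∈ A) :
    T.branchMeasure B ≤ ENNReal.ofReal
      ((∏ j ∈ Finset.range k, ((T.n j : ℝ) + 1)⁻¹) * (A.card / ((T.n k : ℝ) + 1))) := by
  rcases B.eq_empty_or_nonempty with rfl | ⟨ω, hω⟩
  · simp
  let t : ∀ j, Set (Fin (T.n j + 1)) := fun j ↦ if h : j = k then h ▸ (A : Set (Fin (T.n k + 1))) else {ω j}
  have htk : t k = A := by simp [t]
  have htj : ∀ j ∈ Finset.range k, t j = {ω j} := fun j hj ↦ by
    have : j ≠ k := (Finset.mem_range.1 hj).ne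
    simp [t, this]
  have hsub : B ⊆ (Finset.range (k + 1) : Set ℕ).pi t := by
    intro ω' hω' j hj
    rw [Finset.mem_coe, Finset.mem_range, Nat.lt_succ_iff_lt_or_eq] at hj
    rcases hj with hj | rfl
    · rw [htj j (Finset.mem_range.2 hj)]
      exact hB ω' hω' ω hω j hj
    · rw [htk]
      exact hA ω' hω'
  refine (MeasureTheory.measure_mono hsub).trans ?_
  unfold branchMeasure
  rw [MeasureTheory.Measure.infinitePi_pi _ (fun _ _ ↦ MeasurableSet.of_discrete),
    Finset.prod_range_succ, htk, Finset.prod_congr rfl fun j hj ↦ by rw [htj j hj],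
    ENNReal.ofReal_mul (by positivity), ENNReal.ofReal_prod_of_nonneg fun _ _ ↦ by positivity]
  refine mul_le_mul' (Finset.prod_le_prod' fun j _ ↦ le_of_eq ?_) (le_of_eq ?_)
  · rw [ProbabilityTheory.uniformOn_univ]
    simp only [MeasureTheory.Measure.count_singleton, Fintype.card_fin]
    rw [ENNReal.ofReal_inv_of_pos (by positivity), one_div]
    congr 1
    rw [← Nat.cast_add_one, ENNReal.ofReal_natCast]
  · rw [ProbabilityTheory.uniformOn_univ, MeasureTheory.Measure.count_apply_finset,
      ENNReal.ofReal_div_of_pos (by positivity), ENNReal.ofReal_natCast, Fintype.card_fin]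
    congr 1
    rw [← Nat.cast_add_one, ENNReal.ofReal_natCast]

end RatTree

theorem Finset.card_le_of_separated {ι : Type*} (A : Finset ι) (ℓ : ι → ℝ) {g d : ℝ} (hg : 0 < g)
    (hd : 0 ≤ d) (hsep : ∀ i ∈ A, ∀ j ∈ A, i ≠ j → g ≤ |ℓ i - ℓ j|)
    (hdiam : ∀ i ∈ A, ∀ j ∈ A, |ℓ i - ℓ j| ≤ d) : (A.card : ℝ) ≤ d / g + 1 := by
  rcases A.eq_empty_or_nonempty with rfl | hA
  · simp only [Finset.card_empty, Nat.cast_zero]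
    positivity
  obtain ⟨i₀, hi₀, hmin⟩ := A.exists_min_image ℓ hA
  have hcard : A.card ≤ (Finset.range (⌊d / g⌋₊ + 1)).card := by
    refine Finset.card_le_card_of_injOn (fun i ↦ ⌊(ℓ i - ℓ i₀) / g⌋₊) (fun i hi ↦ ?_) ?_
    · simp only [Finset.coe_range, Set.mem_Iio, Nat.lt_succ_iff]
      refine Nat.floor_le_floor ?_
      gcongr
      exact (le_abs_self _).trans (hdiam i hi i₀ hi₀)
    · intro i hi j hj hij
      by_contra hne
      have h1 : ∀ i ∈ A, 0 ≤ (ℓ i - ℓ i₀) / g := fun i hi ↦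
        div_nonneg (sub_nonneg.2 (hmin i hi)) hg.le
      have h2 := Nat.floor_le (h1 i hi)
      have h3 := Nat.lt_floor_add_one ((ℓ i - ℓ i₀) / g)
      have h4 := Nat.floor_le (h1 j hj)
      have h5 := Nat.lt_floor_add_one ((ℓ j - ℓ i₀) / g)
      simp only at hij
      rw [← hij] at h4 h5
      have h6 : |(ℓ i - ℓ i₀) / g - (ℓ j - ℓ i₀) / g| < 1 := by
        rw [abs_lt]
        constructor <;> linarith
      rw [← sub_div, abs_div, abs_of_pos hg, div_lt_one hg, sub_sub_sub_cancel_right] at h6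
      exact (hsep i hi j hj hne).not_gt h6
  rw [Finset.card_range] at hcard
  have h1 : (A.card : ℝ) ≤ ⌊d / g⌋₊ + 1 := by exact_mod_cast hcard
  linarith [Nat.floor_le (show 0 ≤ d / g by positivity)]

theorem Real.min_one_le_rpow {x s : ℝ} (hx : 0 ≤ x) (hs0 : 0 ≤ s) (hs1 : s ≤ 1) :
    min 1 x ≤ x ^ s := by
  rcases le_total x 1 with h | h
  · rw [min_eq_right h]
    exact Real.self_le_rpow_of_le_one hx h hs1
  · rw [min_eq_left h]
    exact Real.one_le_rpow h hs0

namespace RatTree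

variable {O : Set ℚ} {τ c : ℝ} (T : RatTree O τ c)

/-- The mass of a node at level `k`. -/
noncomputable def mass (k : ℕ) : ℝ := ∏ j ∈ Finset.range k, ((T.n j : ℝ) + 1)⁻¹

theorem mass_nonneg (k : ℕ) : 0 ≤ T.mass k := Finset.prod_nonneg fun _ _ ↦ by positivity

theorem inv_n_le (hc : 0 < c) (k : ℕ) :
    ((T.n k : ℝ) + 1)⁻¹ ≤ (T.Q k : ℝ) ^ τ / c / (T.Q (k + 1) : ℝ) ^ 2 := by
  have h0 := T.Q_cast_pos k
  have h1 := T.Q_cast_pos (k + 1)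
  refine (inv_anti₀ (by positivity) (T.le_n k)).trans (le_of_eq ?_)
  field_simp

/-- Only the last factor is needed: by `growth`, its numerator `Q j ^ τ / c` is at most `Q (j + 1) ^
(2 - τ * s)` once `j * (2 - τ * s) ≥ 1`. -/
theorem exists_mass_le (hc : 0 < c) (hc1 : c ≤ 1) (hτ : 2 ≤ τ) {s : ℝ} (hs : τ * s < 2) :
    ∃ k₀, ∀ k ≥ k₀, T.mass k ≤ (T.Q k : ℝ) ^ (-(τ * s)) := by
  obtain ⟨j₀, hj₀⟩ := exists_nat_ge (1 / (2 - τ * s))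
  have hη : 0 < 2 - τ * s := by linarith
  refine ⟨j₀ + 1, fun k hk ↦ ?_⟩
  obtain ⟨j, rfl⟩ : ∃ j, k = j + 1 := ⟨k - 1, by omega⟩
  have hj : (j₀ : ℝ) ≤ j := by exact_mod_cast (by omega : j₀ ≤ j)
  have h0 := T.Q_cast_pos j
  have h1 := T.Q_cast_pos (j + 1)
  have hQ1 : (1 : ℝ) ≤ T.Q j := by exact_mod_cast T.Q_pos j
  set A := (T.Q j : ℝ) ^ τ / c with hA
  have hA1 : 1 ≤ A := by
    rw [hA, one_le_div hc]
    exact hc1.trans (Real.one_le_rpow hQ1 (by linarith))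
  have h2 : A ≤ (T.Q (j + 1) : ℝ) ^ (2 - τ * s) := by
    calc A = A ^ (1 : ℝ) := (Real.rpow_one A).symm
      _ ≤ A ^ (j * (2 - τ * s)) := by
        refine Real.rpow_le_rpow_of_exponent_le hA1 ?_
        rw [div_le_iff₀ hη] at hj₀
        nlinarith
      _ = (A ^ j) ^ (2 - τ * s) := by
        rw [Real.rpow_mul (by positivity), Real.rpow_natCast]
      _ ≤ _ := Real.rpow_le_rpow (by positivity) (T.growth j) hη.le
  calc T.mass (j + 1) = T.mass j * ((T.n j : ℝ) + 1)⁻¹ := Finset.prod_range_succ _ _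
    _ ≤ 1 * (A / (T.Q (j + 1) : ℝ) ^ 2) := by
      refine mul_le_mul (Finset.prod_le_one (fun _ _ ↦ by positivity) fun i _ ↦ ?_) (T.inv_n_le hc j)
        (by positivity) zero_le_one
      exact inv_le_one_of_one_le₀ (by linarith [(Nat.cast_nonneg (T.n i) : (0 : ℝ) ≤ _)])
    _ ≤ (T.Q (j + 1) : ℝ) ^ (2 - τ * s) / (T.Q (j + 1) : ℝ) ^ 2 := by
      rw [one_mul]
      gcongr
    _ = _ := by
      rw [← Real.rpow_two, ← Real.rpow_sub h1]
      congr 1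
      ring

/-- Let `k` be the first level with gap at most `d`. Branches landing in `S` agree before level `k`,
and by separation they use at most `d / gap + 1` children there. Taking `d` below `gap k₀` forces `k
≥ k₀`. -/
theorem exists_branchMeasure_preimage_le (hc : 0 < c) (hc1 : c ≤ 1) (hτ : 2 ≤ τ) {s : ℝ}
    (hs0 : 0 < s) (hs : τ * s < 2) : ∃ C > 0, ∃ ε > 0, ∀ d, 0 < d → d < ε → ∀ S : Set ℝ,
      (∀ x ∈ S, ∀ y ∈ S, |x - y| ≤ d) →
        T.branchMeasure (T.point ⁻¹' S) ≤ ENNReal.ofReal (C * d ^ s) := by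
  classical
  obtain ⟨k₀, hk₀⟩ := T.exists_mass_le hc hc1 hτ hs
  refine ⟨(4 / c) ^ s, by positivity, T.gap k₀, T.gap_pos k₀, fun d hd hdε S hS ↦ ?_⟩
  have hex : ∃ k, T.gap k ≤ d :=
    ((T.tendsto_gap.eventually (gt_mem_nhds hd)).exists).imp fun k hk ↦ hk.le
  set k := Nat.find hex with hk
  have hgk : T.gap k ≤ d := Nat.find_spec hex
  have hgj : ∀ j < k, d < T.gap j := fun j hj ↦ not_le.1 (Nat.find_min hex hj)
  have hkk₀ : k₀ ≤ k := by
    by_contra! h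
    exact (hdε.trans_le (T.gap_antitone h.le)).not_ge hgk
  have hagree : ∀ ω ∈ T.point ⁻¹' S, ∀ ω' ∈ T.point ⁻¹' S, ∀ j < k, ω j = ω' j := fun ω hω ω' hω' ↦
    T.agree_of_abs_sub_lt hτ fun j hj ↦ (hS _ hω _ hω').trans_lt (hgj j hj)
  set A : Finset (Fin (T.n k + 1)) := Finset.univ.filter fun i ↦ ∃ ω ∈ T.point ⁻¹' S, ω k = i with hA
  refine (T.branchMeasure_le k _ hagree A fun ω hω ↦ ?_).trans (ENNReal.ofReal_le_ofReal ?_)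
  · simp only [hA, Finset.mem_filter, Finset.mem_univ, true_and]
    exact ⟨ω, hω, rfl⟩
  have hrep : ∀ i : Fin (T.n k + 1), ∃ ω, i ∈ A → ω ∈ T.point ⁻¹' S ∧ ω k = i := by
    intro i
    by_cases hi : i ∈ A
    · obtain ⟨ω, h⟩ := (Finset.mem_filter.1 hi).2
      exact ⟨ω, fun _ ↦ h⟩
    · exact ⟨fun _ ↦ 0, fun h ↦ absurd h hi⟩
  choose ω hω using hrep
  have hcard := A.card_le_of_separated (fun i ↦ T.point (ω i)) (T.gap_pos k) hd.le
    (fun i hi j hj hij ↦ T.gap_le_abs_sub hτ (hagree _ (hω i hi).1 _ (hω j hj).1)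
      (by rw [(hω i hi).2, (hω j hj).2]; exact hij))
    (fun i hi j hj ↦ hS _ (hω i hi).1 _ (hω j hj).1)
  have h0 := T.Q_cast_pos k
  have h1 := T.Q_cast_pos (k + 1)
  have hcard2 : (A.card : ℝ) ≤ 4 * d * (T.Q (k + 1) : ℝ) ^ 2 := by
    have h2 : 1 ≤ d / T.gap k := (one_le_div (T.gap_pos k)).2 hgk
    have h3 : d / T.gap k = 2 * d * (T.Q (k + 1) : ℝ) ^ 2 := by
      unfold gap
      field_simp
    linarith
  -- The trivial bound `1` and the separation bound are interpolated by the exponent `s ≤ 1`, so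
  -- that `Q k ^ (τ * s)` cancels against the mass.
  have hratio : (A.card : ℝ) / ((T.n k : ℝ) + 1) ≤ (4 / c * d * (T.Q k : ℝ) ^ τ) ^ s := by
    have hs1 : s ≤ 1 := by nlinarith
    refine le_trans (le_min ?_ ?_) (Real.min_one_le_rpow (by positivity) hs0.le hs1)
    · rw [div_le_one (by positivity)]
      have := Finset.card_le_univ A
      rw [Fintype.card_fin] at this
      exact_mod_cast this
    · rw [div_eq_mul_inv]
      calc (A.card : ℝ) * ((T.n k : ℝ) + 1)⁻¹
          ≤ 4 * d * (T.Q (k + 1) : ℝ) ^ 2 * ((T.Q k : ℝ) ^ τ / c / (T.Q (k + 1) : ℝ) ^ 2) :=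
            mul_le_mul hcard2 (T.inv_n_le hc k) (by positivity) (by positivity)
        _ = _ := by field_simp
  calc _ ≤ (T.Q k : ℝ) ^ (-(τ * s)) * (4 / c * d * (T.Q k : ℝ) ^ τ) ^ s :=
        mul_le_mul (hk₀ k hkk₀) hratio (by positivity) (by positivity)
    _ = _ := by
      rw [Real.mul_rpow (by positivity) (by positivity), Real.mul_rpow (by positivity) (by positivity),
        ← Real.rpow_mul h0.le, Real.rpow_neg h0.le]
      field_simp

end RatTree

open MeasureTheory Filter Topology in
/-- A mass distribution principle. -/
theorem absolutelyContinuous_hausdorffMeasure {μ : Measure ℝ} {s C ε : ℝ} (hs : 0 < s) (hC : 0 < C)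
    (hε : 0 < ε) (h : ∀ d, 0 < d → d < ε → ∀ S : Set ℝ, IsClosed S →
      (∀ x ∈ S, ∀ y ∈ S, |x - y| ≤ d) → μ S ≤ ENNReal.ofReal (C * d ^ s)) : μ ≪ μH[s] := by
  have hC' : ENNReal.ofReal C ≠ 0 := by simpa using hC
  have key : (ENNReal.ofReal C)⁻¹ • μ ≤ μH[s] := by
    refine Measure.le_hausdorffMeasure s _ (ENNReal.ofReal (ε / 2)) (by simpa using hε) fun S hS ↦ ?_
    rw [Measure.smul_apply, smul_eq_mul, mul_comm, ← div_eq_mul_inv]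
    refine ENNReal.div_le_of_le_mul' ?_
    refine (measure_mono subset_closure).trans ?_
    rw [← Metric.ediam_closure] at hS ⊢
    have hfin : Metric.ediam (closure S) ≠ ⊤ := ne_top_of_le_ne_top ENNReal.ofReal_ne_top hS
    set d := (Metric.ediam (closure S)).toReal with hd
    have hdε : d ≤ ε / 2 := ENNReal.toReal_le_of_le_ofReal (by positivity) hS
    have hdist : ∀ x ∈ closure S, ∀ y ∈ closure S, |x - y| ≤ d := by
      intro x hx y hy
      rw [← Real.dist_eq, hd, dist_edist]
      exact ENNReal.toReal_mono hfin (Metric.edist_le_ediam_of_mem hx hy)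
    have hd0 : 0 ≤ d := ENNReal.toReal_nonneg
    -- The hypothesis covers only positive `d`, so diameter zero is reached by letting `d'` decrease
    -- to `d`.
    have hlim : Tendsto (fun d' : ℝ ↦ ENNReal.ofReal (C * d' ^ s)) (𝓝[>] d)
        (𝓝 (ENNReal.ofReal (C * d ^ s))) := by
      refine ENNReal.tendsto_ofReal (tendsto_nhdsWithin_of_tendsto_nhds ?_)
      exact (Real.continuous_rpow_const hs.le).continuousAt.tendsto.const_mul C
    have hle : μ (closure S) ≤ ENNReal.ofReal (C * d ^ s) := by
      refine ge_of_tendsto hlim ?_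
      filter_upwards [Ioo_mem_nhdsGT (show d < ε by linarith)] with d' hd'
      exact h d' (hd0.trans_lt hd'.1) hd'.2 _ isClosed_closure
        fun x hx y hy ↦ (hdist x hx y hy).trans hd'.1.le
    refine hle.trans (le_of_eq ?_)
    rw [ENNReal.ofReal_mul hC.le, ← ENNReal.ofReal_rpow_of_nonneg hd0 hs.le, hd,
      ENNReal.ofReal_toReal hfin]
  intro S hS
  have := key S
  rw [hS, Measure.smul_apply, smul_eq_mul, nonpos_iff_eq_zero, mul_eq_zero] at this
  rcases this with h1 | h1
  · simp at h1
  · exact h1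

-- The measure is the law of the limit point of a random branch. Arbitrarily close approximants are
-- asserted in place of infinitely many; `infinite_of_irrational` converts one into the other.
open MeasureTheory Filter Topology in
theorem exists_measure_approximable {O : Set ℚ} {c : ℝ} (hc : 0 < c)
    (hO : ∀ ρ > 0, ∀ᶠ Q : ℕ in atTop, ∀ x : ℝ, ∃ F : Finset ℚ,
      (∀ y ∈ F, y ∈ O ∧ |(y : ℝ) - x| ≤ ρ ∧ y.den ≤ Q) ∧ c * ρ * Q ^ 2 ≤ F.card)
    {τ : ℝ} (hτ : 2 ≤ τ) : ∃ μ : Measure ℝ, IsProbabilityMeasure μ ∧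
      (∀ s, 0 < s → τ * s < 2 → μ ≪ μH[s]) ∧
      ∀ᵐ x : ℝ ∂μ, ∀ m : ℕ, ∃ y : ℚ, y ∈ O ∧ |x - y| ≤ 1 / (y.den : ℝ) ^ τ ∧
        |x - y| ≤ 1 / ((m : ℝ) + 1) := by
  -- The constant is capped at `1` because the mass estimate requires `c ≤ 1`.
  obtain ⟨T⟩ := exists_ratTree (τ := τ) (c := min c 1) (lt_min hc one_pos) fun ρ hρ ↦ by
    filter_upwards [hO ρ hρ] with Q hQ x
    obtain ⟨F, hF1, hF2⟩ := hQ x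
    refine ⟨F, hF1, le_trans ?_ hF2⟩
    gcongr
    exact min_le_left _ _
  have hc0 : 0 < min c 1 / 16 := by have := lt_min hc one_pos; positivity
  have hc1 : min c 1 / 16 ≤ 1 := by linarith [min_le_right c 1]
  have hmeas := T.measurable_point hτ
  refine ⟨T.branchMeasure.map T.point, Measure.isProbabilityMeasure_map hmeas.aemeasurable,
    fun s hs0 hs ↦ ?_, ?_⟩
  · obtain ⟨C, hC, ε, hε, h⟩ := T.exists_branchMeasure_preimage_le hc0 hc1 hτ hs0 hs
    refine absolutelyContinuous_hausdorffMeasure hs0 hC hε fun d hd hdε S hcl hS ↦ ?_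
    rw [Measure.map_apply hmeas hcl.measurableSet]
    exact h d hd hdε S hS
  · have hms : MeasurableSet {x : ℝ | ∀ m : ℕ, ∃ y : ℚ, y ∈ O ∧ |x - y| ≤ 1 / (y.den : ℝ) ^ τ ∧
        |x - y| ≤ 1 / ((m : ℝ) + 1)} := by
      simp only [Set.ofPred_forall, Set.ofPred_exists]
      refine MeasurableSet.iInter fun m ↦ MeasurableSet.iUnion fun y ↦ ?_
      have hle : ∀ b : ℝ, MeasurableSet {x : ℝ | |x - y| ≤ b} := fun b ↦
        (isClosed_le (by fun_prop) continuous_const).measurableSet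
      exact (MeasurableSet.const _).inter ((hle _).inter (hle _))
    rw [ae_map_iff hmeas.aemeasurable hms]
    refine Eventually.of_forall fun ω m ↦ ?_
    have hlim : Tendsto (fun k ↦ T.radius 0 / 2 ^ k) atTop (𝓝 0) :=
      tendsto_const_nhds.div_atTop (tendsto_pow_atTop_atTop_of_one_lt one_lt_two)
    obtain ⟨k, hk, hk1⟩ := ((hlim.eventually (gt_mem_nhds (show (0 : ℝ) < 1 / ((m : ℝ) + 1) by
      positivity))).and (eventually_ge_atTop 1)).exists
    obtain ⟨j, rfl⟩ : ∃ j, k = j + 1 := ⟨k - 1, by omega⟩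
    have h1 := T.abs_center_sub_point_le hτ (j + 1) ω
    rw [abs_sub_comm] at h1
    refine ⟨T.center (j + 1) ω, T.sel_mem _ _ _, h1.trans ?_, h1.trans ?_⟩
    · have h2 : ((T.center (j + 1) ω).den : ℝ) ≤ T.Q (j + 1) := by
        exact_mod_cast T.den_sel_le _ _ _
      have h3 : (0 : ℝ) < (T.center (j + 1) ω).den := by
        exact_mod_cast (T.center (j + 1) ω).pos
      unfold RatTree.radius
      apply one_div_le_one_div_of_le (by positivity)
      have h4 := Real.rpow_le_rpow h3.le h2 (by linarith : 0 ≤ τ)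
      have := Real.rpow_nonneg (T.Q_cast_pos (j + 1)).le τ
      linarith
    · have := T.radius_add_le hτ 0 (j + 1)
      rw [zero_add] at this
      exact this.trans hk.le

/-! ### The dimension of the level sets -/

theorem infinite_approx_of_le {P : ℚ → Prop} {x t t' : ℝ} (htt' : t ≤ t')
    (h : ∃ C : ℝ, {y : ℚ | P y ∧ |x - (y : ℝ)| ≤ C / (y.den : ℝ) ^ t'}.Infinite) :
    ∃ C : ℝ, {y : ℚ | |x - (y : ℝ)| ≤ C / (y.den : ℝ) ^ t}.Infinite := by
  obtain ⟨C, hC⟩ := h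
  refine ⟨|C|, hC.mono fun y hy ↦ le_trans hy.2 ?_⟩
  have hd : (1 : ℝ) ≤ y.den := by exact_mod_cast y.pos
  gcongr
  exact le_abs_self C

open MeasureTheory in
theorem dimH_nonCuspidalExponent_le (Γ : Subgroup SL(2, ℤ)) [Γ.FiniteIndex] (r : ℝ)
    (f : UpperHalfPlane → ℂ) (τ : ℝ≥0∞) (hτ : 2 ≤ τ) :
    dimH {x : ℝ | nonCuspidalExponent Γ r f x = (τ : EReal)} ≤ 2 / τ := by
  refine le_of_forall_gt fun b hb ↦ ?_
  obtain ⟨s, hs, hsb⟩ := ENNReal.lt_iff_exists_nnreal_btwn.1 hb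
  refine lt_of_le_of_lt (dimH_le_of_hausdorffMeasure_ne_top ?_) hsb
  have hs0 : 0 < s := by
    exact_mod_cast pos_of_gt hs
  -- As `s > 2/τ`, an order `t` fits strictly between `2/s` and `τ`.
  obtain ⟨t, ht0, hts, htτ⟩ : ∃ t : ℝ, 0 < t ∧ 2 < t * s ∧ (t : EReal) < τ := by
    have hs0' : (0 : ℝ) < s := by exact_mod_cast hs0
    induction τ with
    | top =>
      refine ⟨2 / s + 1, by positivity, ?_, EReal.coe_lt_top _⟩
      rw [add_mul, div_mul_cancel₀ _ hs0'.ne']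
      linarith
    | coe T =>
      have hT : (2 : ℝ) ≤ T := by exact_mod_cast hτ
      have hT0 : (0 : ℝ) < T := by linarith
      have h1 : (2 : ℝ) / T < s := by
        have h2 : T ≠ 0 := by
          rintro rfl
          simp at hT0
        have h3 : ((2 / T : NNReal) : ℝ≥0∞) < s := by
          rw [ENNReal.coe_div h2]
          exact_mod_cast hs
        exact_mod_cast h3
      have h2 : 2 / (s : ℝ) < T := by
        rw [div_lt_iff₀ hT0] at h1
        rw [div_lt_iff₀ hs0']
        linarith
      obtain ⟨t, ht1, ht2⟩ := exists_between h2
      refine ⟨t, lt_trans (by positivity) ht1, (div_lt_iff₀ hs0').1 ht1, ?_⟩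
      rw [EReal.coe_nnreal_eq_coe_real]
      exact EReal.coe_lt_coe_iff.2 ht2
  refine ne_of_eq_of_ne (measure_mono_null (fun x hx ↦ ?_)
    (hausdorffMeasure_approximable ht0 (by exact_mod_cast hs0) hts)) ENNReal.zero_ne_top
  rw [Set.mem_ofPred_eq] at hx
  rw [← hx] at htτ
  obtain ⟨_, ⟨t', rfl, ht'⟩, hlt⟩ := lt_sSup_iff.1 htτ
  exact infinite_approx_of_le (EReal.coe_lt_coe_iff.1 hlt).le ht'

/-- Finitely many approximants would leave a positive minimal distance to `x`. -/
theorem infinite_of_irrational {P : ℚ → Prop} {x t : ℝ} (hx : x ∉ Set.range ((↑) : ℚ → ℝ))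
    (h : ∀ m : ℕ, ∃ y : ℚ, P y ∧ |x - y| ≤ 1 / (y.den : ℝ) ^ t ∧ |x - y| ≤ 1 / ((m : ℝ) + 1)) :
    {y : ℚ | P y ∧ |x - (y : ℝ)| ≤ 1 / (y.den : ℝ) ^ t}.Infinite := by
  intro hfin
  obtain ⟨y₁, h1, h2, -⟩ := h 0
  obtain ⟨y₀, -, hmin⟩ := Set.exists_min_image _ (fun y : ℚ ↦ |x - y|) hfin ⟨y₁, h1, h2⟩
  have hpos : 0 < |x - y₀| := abs_pos.2 (sub_ne_zero.2 fun h ↦ hx ⟨y₀, h.symm⟩)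
  obtain ⟨m, hm⟩ := exists_nat_one_div_lt hpos
  obtain ⟨y, h3, h4, h5⟩ := h m
  exact (h5.trans_lt hm).not_ge (hmin y ⟨h3, h4⟩)

open MeasureTheory in
theorem le_dimH_nonCuspidalExponent {Γ : Subgroup SL(2, ℤ)} [Γ.FiniteIndex] {r : ℝ}
    {μ : Γ → Circle} {f : UpperHalfPlane → ℂ} (hf : IsModularFormOfWeight Γ r μ f)
    (hcusp : ¬ ∀ 𝔞 : OnePoint ℚ, IsCuspidalAt Γ r f 𝔞) {T : NNReal} (hT : (2 : ℝ) ≤ T) :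
    2 / (T : ℝ≥0∞) ≤ dimH {x : ℝ | nonCuspidalExponent Γ r f x = ((T : ℝ) : EReal)} := by
  obtain ⟨C, hC⟩ := exists_noncuspidal_rat_near hf hcusp
  obtain ⟨c, hc, hcard⟩ := exists_card_ge (O := {y : ℚ | ¬ IsCuspidalAt Γ r f (y : OnePoint ℚ)}) hC
  obtain ⟨ν, hν, hac, hae⟩ := exists_measure_approximable hc hcard hT
  have hT0 : (0 : ℝ) < T := by linarith
  have hrat : ∀ᵐ x ∂ν, x ∉ Set.range ((↑) : ℚ → ℝ) := by
    -- Any exponent in `(0, 2/T)` would do; `1/T` is a convenient one.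
    have h1 : μH[((1 / T : NNReal) : ℝ)] (Set.range ((↑) : ℚ → ℝ)) = 0 := by
      refine hausdorffMeasure_of_dimH_lt ?_
      rw [(Set.countable_range _).dimH_zero]
      have hT0' : 0 < T := by exact_mod_cast hT0
      have : 0 < 1 / T := by positivity
      exact_mod_cast this
    refine measure_eq_zero_iff_ae_notMem.1 (hac _ (by push_cast; positivity) ?_ h1)
    push_cast
    rw [mul_one_div_cancel hT0.ne']
    norm_num
  have hupper : ∀ᵐ x : ℝ ∂ν, ∀ n : ℕ,
      ¬ ∃ C : ℝ, {y : ℚ |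
        |x - (y : ℝ)| ≤ C / (y.den : ℝ) ^ ((T : ℝ) + 1 / ((n : ℝ) + 1))}.Infinite := by
    refine ae_all_iff.2 fun n ↦ ?_
    have hδ : 0 < 1 / ((n : ℝ) + 1) := by positivity
    -- This `s` exceeds `2 / (T + 1/(n+1))`, making the set `s`-null, yet is below `2/T`, so `ν`
    -- inherits the nullity.
    obtain ⟨s, hs1, hs2⟩ := exists_between (div_lt_div_of_pos_left two_pos hT0
      (by linarith : (T : ℝ) < T + 1 / ((n : ℝ) + 1)))
    have hs0 : 0 < s := lt_trans (by positivity) hs1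
    have h1 := hausdorffMeasure_approximable (t := (T : ℝ) + 1 / ((n : ℝ) + 1)) (s := s)
      (by positivity) hs0 (by rwa [div_lt_iff₀' (by positivity)] at hs1)
    have h2 := hac s hs0 (by rwa [lt_div_iff₀' hT0] at hs2) h1
    rw [measure_eq_zero_iff_ae_notMem] at h2
    exact h2
  have hmem : ∀ᵐ x ∂ν, x ∈ {x : ℝ | nonCuspidalExponent Γ r f x = ((T : ℝ) : EReal)} := by
    filter_upwards [hae, hrat, hupper] with x h1 h2 h3
    refine le_antisymm (sSup_le ?_) (le_sSup ⟨T, rfl, 1, infinite_of_irrational h2 h1⟩)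
    rintro _ ⟨t, rfl, ht⟩
    rw [EReal.coe_le_coe_iff]
    by_contra! hlt
    obtain ⟨n, hn⟩ := exists_nat_one_div_lt (sub_pos.2 hlt)
    exact h3 n (infinite_approx_of_le (by linarith) ht)
  refine le_of_forall_lt fun b hb ↦ ?_
  obtain ⟨s, hbs, hs⟩ := ENNReal.lt_iff_exists_nnreal_btwn.1 hb
  refine lt_of_lt_of_le hbs (le_dimH_of_hausdorffMeasure_ne_zero fun h0 ↦ ?_)
  have hs0 : (0 : ℝ) < s := by
    exact_mod_cast pos_of_gt hbs
  have hsT : (T : ℝ) * s < 2 := by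
    have h2 : T ≠ 0 := by
      rintro rfl
      simp at hT0
    have h3 : (s : ℝ≥0∞) < ((2 / T : NNReal) : ℝ≥0∞) := by
      rw [ENNReal.coe_div h2]
      exact_mod_cast hs
    have h4 : (s : ℝ) < 2 / T := by exact_mod_cast h3
    rwa [lt_div_iff₀' hT0] at h4
  have h5 := hac s hs0 hsT h0
  have h6 := measure_eq_zero_iff_ae_notMem.1 h5
  obtain ⟨x, hx1, hx2⟩ := (hmem.and h6).exists
  exact hx2 hx1

theorem corollary6p3 (Γ : Subgroup SL(2, ℤ)) [Γ.FiniteIndex] (r : ℝ) (μ : Γ → Circle)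
    (f : UpperHalfPlane → ℂ) (hf : IsModularFormOfWeight Γ r μ f)
    (hcusp : ¬ ∀ 𝔞 : OnePoint ℚ, IsCuspidalAt Γ r f 𝔞)
    (τ : ℝ≥0∞) (hτ : 2 ≤ τ) :
    dimH {x : ℝ | nonCuspidalExponent Γ r f x = (τ : EReal)} = 2 / τ := by
  refine le_antisymm (dimH_nonCuspidalExponent_le Γ r f τ hτ) ?_
  induction τ with
  -- The lower bound is vacuous here, as `2/∞ = 0`.
  | top => simp
  | coe T => exact le_dimH_nonCuspidalExponent hf hcusp (by exact_mod_cast hτ)
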